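/- Let $M$ be a compact connected complex manifold of dimension $m$ which is hyperelliptic, i.e. there is a finite étale surjective holomorphic map $T=\mathbb C^m/\Lambda\to M$ from a complex torus ($\Lambda\subset\mathbb C^m$ a complete lattice). Then the following are equivalent: 1. $M$ carries a holomorphic quadric structure: $M$ is covered by open sets $U_i$ with holomorphic embeddings $\varphi_i:U_i\hookrightarrow \mathcal Q_m=\{[Z]\in\mathbb P_{m+1}(\mathbb C)\mid Z_0^2+\dots+Z_{m+1}^2=0\}$ such that each $\varphi_i\circ\varphi_j^{-1}$, defined on $\varphi_j(U_i\cap U_j)$, is the restriction of an automorphism of $\mathcal Q_m$, i.e. of a projective transformation $[Z]\mapsto[AZ]$ with $A\in O(m+2,\mathbb C)$. 2. $M$ carries a holomorphic conformal structure: for some holomorphic line bundle $L$ on $M$ there is a holomorphic section $g\in H^0(M,S^2\Omega^1_M\otimes L^*)$ which is non-degenerate at every point. 3. $M$ is a complex torus or is conformally hyperelliptic. Here $M$ is called conformally hyperelliptic if it is not a torus, but is isomorphic to $\mathbb C^m/\Gamma$ for a fixed point free group $\Gamma$ (no element other than the identity has a fixed point) of conformal affine maps $z\mapsto cAz+b$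 ($A\in O(m,\mathbb C)$, $b\in\mathbb C^m$, $c\in\mathbb C^*$) which contains the translations by a complete lattice of $\mathbb C^m$ as a subgroup of finite index. -/

import Mathlib

open scoped Manifold ContDiff Bundle LinearAlgebra.Projectivization Matrix

noncomputable section

namespace QuadricStructures

/-- The complex vector space `ℂ^m`, the model space of `m`-dimensional complex manifolds. -/
abbrev Cn (m : ℕ) : Type := Fin m → ℂ

/-! ### The quadric `Q_m` and quadric structures -/

/-- The quadric `Q_m = {[Z_0 : … : Z_{m+1}] | Z_0 ^ 2 + … + Z_{m+1} ^ 2 = 0}` in `ℙ_{m+1}(ℂ)`. -/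
def quadric (m : ℕ) : Set (ℙ ℂ (Cn (m + 2))) :=
  {p | p.rep ⬝ᵥ p.rep = 0}

/-- Membership in the quadric may be tested on any representing vector. -/
theorem mk_mem_quadric_iff (m : ℕ) (Z : Cn (m + 2)) (hZ : Z ≠ 0) :
    Projectivization.mk ℂ Z hZ ∈ quadric m ↔ Z ⬝ᵥ Z = 0 := by
  obtain ⟨a, ha⟩ := Projectivization.exists_smul_eq_mk_rep ℂ Z hZ
  simp only [quadric, Set.mem_ofPred_eq, ← ha]
  simp [Units.smul_def]

/-- The projective transformation `[Z] ↦ [A Z]` given by a complex orthogonal matrix `A`. -/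
def projOrthogonal {n : ℕ} (A : Matrix (Fin n) (Fin n) ℂ) (hA : Aᵀ * A = 1) :
    ℙ ℂ (Cn n) → ℙ ℂ (Cn n) :=
  Projectivization.map A.mulVecLin fun v w h => by
    have h' : Aᵀ *ᵥ (A *ᵥ v) = Aᵀ *ᵥ (A *ᵥ w) := congrArg (Aᵀ *ᵥ ·) h
    simpa [Matrix.mulVec_mulVec, hA] using h'

/-- `F` is an automorphism of `Q_m`, i.e. it is induced by an element of `O(m+2, ℂ)`.
The automorphism group of `Q_m` is `PO(m+2, ℂ)`. -/
def IsQuadricAutomorphism (m : ℕ) (F : ℙ ℂ (Cn (m + 2)) → ℙ ℂ (Cn (m + 2))) : Prop :=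
  ∃ (A : Matrix (Fin (m + 2)) (Fin (m + 2)) ℂ) (hA : Aᵀ * A = 1), F = projOrthogonal A hA

/-- `φ` restricts to a holomorphic embedding `U ↪ Q_m` of the open subset `U` of the
`m`-dimensional complex manifold `M`: it maps `U` injectively into `Q_m`, and near each point of
`U` it can be written as `φ = [Z]` with `Z` a holomorphic map to `ℂ^{m+2} ∖ {0}` such that
`dZ` is injective modulo the line `ℂ Z` (that is, `dφ` is injective). -/
structure IsQuadricChart (m : ℕ) {M : Type*} [TopologicalSpace M] [ChartedSpace (Cn m) M]
    (U : Set M) (φ : M → ℙ ℂ (Cn (m + 2))) : Prop where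
  isOpen : IsOpen U
  mapsTo : Set.MapsTo φ U (quadric m)
  injOn : Set.InjOn φ U
  immersive : ∀ x ∈ U, ∃ Z : M → Cn (m + 2),
    ContMDiffAt 𝓘(ℂ, Cn m) 𝓘(ℂ, Cn (m + 2)) ω Z x ∧
    (∀ᶠ y in nhds x, ∃ hy : Z y ≠ 0, φ y = Projectivization.mk ℂ (Z y) hy) ∧
    ∀ (v : TangentSpace 𝓘(ℂ, Cn m) x) (c : ℂ),
      mfderiv 𝓘(ℂ, Cn m) 𝓘(ℂ, Cn (m + 2)) Z x v = (c • Z x : Cn (m + 2)) → v = 0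

/-- `M` carries a holomorphic quadric structure: it is covered by the domains of holomorphic
embeddings `φ_i : U_i ↪ Q_m` all of whose transition maps are restrictions of automorphisms of
`Q_m`. -/
def HasQuadricStructure.{u} (m : ℕ) (M : Type u) [TopologicalSpace M]
    [ChartedSpace (Cn m) M] : Prop :=
  ∃ (ι : Type u) (U : ι → Set M) (φ : ι → M → ℙ ℂ (Cn (m + 2))),
    (∀ x, ∃ i, x ∈ U i) ∧
    (∀ i, IsQuadricChart m (U i) (φ i)) ∧
    ∀ i j, ∃ F, IsQuadricAutomorphism m F ∧ ∀ x ∈ U i ∩ U j, φ i x = F (φ j x)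

/-! ### Holomorphic conformal structures -/

/-- A holomorphic line bundle on the `m`-dimensional complex manifold `M`. -/
structure HolomorphicLineBundle (m : ℕ) (M : Type*) [TopologicalSpace M]
    [ChartedSpace (Cn m) M] where
  /-- the fibres of the bundle -/
  Fib : M → Type
  [addCommGroup : ∀ x, AddCommGroup (Fib x)]
  [module : ∀ x, Module ℂ (Fib x)]
  [topologicalSpace : ∀ x, TopologicalSpace (Fib x)]
  [isTopologicalAddGroup : ∀ x, IsTopologicalAddGroup (Fib x)]
  [continuousSMul : ∀ x, ContinuousSMul ℂ (Fib x)]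
  [totalSpace : TopologicalSpace (Bundle.TotalSpace ℂ Fib)]
  [fiberBundle : FiberBundle ℂ Fib]
  [vectorBundle : VectorBundle ℂ ℂ Fib]
  [holomorphic : ContMDiffVectorBundle ω ℂ Fib 𝓘(ℂ, Cn m)]

attribute [instance] HolomorphicLineBundle.addCommGroup HolomorphicLineBundle.module
  HolomorphicLineBundle.topologicalSpace HolomorphicLineBundle.isTopologicalAddGroup
  HolomorphicLineBundle.continuousSMul HolomorphicLineBundle.totalSpace
  HolomorphicLineBundle.fiberBundle HolomorphicLineBundle.vectorBundle
  HolomorphicLineBundle.holomorphic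

/-- A holomorphic conformal structure on `M` with values in the line bundle `N`: a nondegenerate
holomorphic section `g` of `S²Ω_M ⊗ N`, that is, of symmetric bilinear maps
`T_x M × T_x M → N_x`. (`N` is the dual `L*` of the line bundle `L` if one writes the structure as
a section of `S²Ω_M ⊗ L*`.) -/
structure HolomorphicConformalStructure (m : ℕ) (M : Type*) [TopologicalSpace M]
    [ChartedSpace (Cn m) M] [IsManifold 𝓘(ℂ, Cn m) ω M] (N : HolomorphicLineBundle m M) where
  /-- the bilinear form on each tangent space -/
  form (x : M) : TangentSpace 𝓘(ℂ, Cn m) x →L[ℂ] TangentSpace 𝓘(ℂ, Cn m) x →L[ℂ] N.Fib x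
  symm (x : M) (v w : TangentSpace 𝓘(ℂ, Cn m) x) : form x v w = form x w v
  nondegenerate (x : M) (v : TangentSpace 𝓘(ℂ, Cn m) x) : (∀ w, form x v w = 0) → v = 0
  holomorphic : ContMDiff 𝓘(ℂ, Cn m) (𝓘(ℂ, Cn m).prod 𝓘(ℂ, Cn m →L[ℂ] Cn m →L[ℂ] ℂ)) ω
    (fun x => Bundle.TotalSpace.mk' (Cn m →L[ℂ] Cn m →L[ℂ] ℂ)
      (E := fun x : M =>
        TangentSpace 𝓘(ℂ, Cn m) x →L[ℂ] TangentSpace 𝓘(ℂ, Cn m) x →L[ℂ] N.Fib x) x (form x))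

/-- `M` carries a holomorphic conformal structure. -/
def HasHolomorphicConformalStructure (m : ℕ) (M : Type*) [TopologicalSpace M]
    [ChartedSpace (Cn m) M] [IsManifold 𝓘(ℂ, Cn m) ω M] : Prop :=
  ∃ N : HolomorphicLineBundle m M, Nonempty (HolomorphicConformalStructure m M N)

/-! ### Tori, hyperelliptic and conformally hyperelliptic manifolds -/

/-- `Λ` is a complete lattice in `ℂ^m`: a discrete subgroup spanning `ℂ^m` over `ℝ`. -/
def IsCompleteLattice {m : ℕ} (Λ : Submodule ℤ (Cn m)) : Prop :=
  ∃ _ : DiscreteTopology Λ, IsZLattice ℝ Λ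

/-- `f` is a holomorphic local isomorphism (étale map) from the torus `ℂ^m / Λ` to `M`. As the
complex structure of `ℂ^m / Λ` is the one for which the projection `ℂ^m → ℂ^m / Λ` is locally
biholomorphic, this says that the composite `ℂ^m → ℂ^m / Λ → M` is locally biholomorphic. -/
def IsEtaleFromTorus {m : ℕ} {M : Type*} [TopologicalSpace M] [ChartedSpace (Cn m) M]
    (Λ : Submodule ℤ (Cn m)) (f : Cn m ⧸ Λ → M) : Prop :=
  IsLocalDiffeomorph 𝓘(ℂ, Cn m) 𝓘(ℂ, Cn m) ω fun z : Cn m => f (Submodule.Quotient.mk z)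

/-- `M` is a complex torus: it is biholomorphic to `ℂ^m / Λ` for a complete lattice `Λ`. -/
def IsComplexTorus (m : ℕ) (M : Type*) [TopologicalSpace M] [ChartedSpace (Cn m) M] : Prop :=
  ∃ (Λ : Submodule ℤ (Cn m)) (f : Cn m ⧸ Λ → M),
    IsCompleteLattice Λ ∧ IsEtaleFromTorus Λ f ∧ Function.Bijective f

/-- `M` is hyperelliptic: a finite étale quotient of a complex torus `ℂ^m / Λ`. -/
def IsHyperelliptic (m : ℕ) (M : Type*) [TopologicalSpace M] [ChartedSpace (Cn m) M] : Prop :=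
  ∃ (Λ : Submodule ℤ (Cn m)) (f : Cn m ⧸ Λ → M),
    IsCompleteLattice Λ ∧ IsEtaleFromTorus Λ f ∧ Function.Surjective f ∧
      ∀ y, (f ⁻¹' {y}).Finite

/-- `σ` is a conformal affine map `z ↦ c A z + b` with `A ∈ O(m, ℂ)`, `b ∈ ℂ^m`, `c ∈ ℂ^*`. -/
def IsConformalAffine {m : ℕ} (σ : Cn m ≃ᵃ[ℂ] Cn m) : Prop :=
  ∃ (A : Matrix (Fin m) (Fin m) ℂ) (b : Cn m) (c : ℂ),
    Aᵀ * A = 1 ∧ c ≠ 0 ∧ ∀ z, σ z = c • (A *ᵥ z) + b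

/-- The group of translations of `ℂ^m` by the elements of `Λ`. -/
def translations {m : ℕ} (Λ : Submodule ℤ (Cn m)) : Subgroup (Cn m ≃ᵃ[ℂ] Cn m) :=
  (AddSubgroup.toSubgroup Λ.toAddSubgroup).map (AffineEquiv.constVAddHom ℂ (Cn m))

/-- `M` is isomorphic to the quotient of `ℂ^m` by the group `Γ`, by means of a surjective locally
biholomorphic map `ℂ^m → M` whose fibres are exactly the orbits of `Γ`. -/
def IsQuotientBy {m : ℕ} (M : Type*) [TopologicalSpace M] [ChartedSpace (Cn m) M]
    (Γ : Subgroup (Cn m ≃ᵃ[ℂ] Cn m)) : Prop :=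
  ∃ p : Cn m → M, IsLocalDiffeomorph 𝓘(ℂ, Cn m) 𝓘(ℂ, Cn m) ω p ∧ Function.Surjective p ∧
    ∀ z w, p z = p w ↔ ∃ γ ∈ Γ, γ z = w

/-- `M` is conformally hyperelliptic: it is not a torus, but it is isomorphic to a quotient of
`ℂ^m` by a fixed point free group of conformal affine maps which contains (the translations by) a
complete lattice as a subgroup of finite index. -/
def IsConformallyHyperelliptic (m : ℕ) (M : Type*) [TopologicalSpace M]
    [ChartedSpace (Cn m) M] : Prop :=
  ¬ IsComplexTorus m M ∧
  ∃ Γ : Subgroup (Cn m ≃ᵃ[ℂ] Cn m),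
    (∀ γ ∈ Γ, IsConformalAffine γ) ∧
    (∀ γ ∈ Γ, ∀ z, γ z = z → γ = 1) ∧
    (∃ Λ : Submodule ℤ (Cn m), IsCompleteLattice Λ ∧ translations Λ ≤ Γ ∧
      ((translations Λ).subgroupOf Γ).FiniteIndex) ∧
    IsQuotientBy M Γ

end QuadricStructures

end

namespace QuadricStructures

/-! ### Deck transformations of the universal covering of a hyperelliptic manifold -/

/-! Everything is pulled back along `p : ℂ^m → ℂ^m / Λ → M`. Since `p` is a covering by a simply
connected space, its fibres are the orbits of its deck transformations. Finiteness of the fibres of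
`f` makes the derivative of a deck transformation periodic under a multiple of `Λ`, so by
Liouville's theorem it is constant: deck transformations are affine (`exists_mem_deckGroup_coe_eq`),
and the translations by `Λ` have finite index among them.

A quadric structure and a conformal structure both induce on `ℂ^m` a holomorphic conformal class
invariant under deck transformations (`IsInvariantConformalClass`). For a quadric structure with
local lifts `Z` it is the class of `dZ · dZ`: as `Z · Z = 0`, replacing `Z` by `a Z` multiplies this
form by `a ^ 2`, and orthogonal matrices preserve it. Ratios of coefficients of the class that do
not depend on scale are entire and `Λ`-periodic, hence constant
(`IsInvariantConformalClass.exists_eq_smul`). In linear coordinates where the constant form is the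
dot product, the deck group consists of conformal affine maps, so `M` is a torus or conformally
hyperelliptic.

Conversely, let `M = ℂ^m / Γ` with `Γ` free and conformal affine. Cover `M` by domains of sections
of `p`, any two of which differ by one element of `Γ` (`nonempty_sectionCover`). Composing the
sections with the standard embedding of `ℂ^m` into the quadric gives quadric charts, because
conformal affine maps extend to elements of `O(m+2, ℂ)` (`exists_mulVec_quadricLift`). Pulling back
the dot product along the sections gives a conformal structure with values in the flat line bundle
defined by the conformal factors. -/

theorem isCoveringMap_mk {m : ℕ} (Λ : Submodule ℤ (Cn m)) [DiscreteTopology Λ] :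
    IsCoveringMap (Submodule.Quotient.mk : Cn m → Cn m ⧸ Λ) :=
  (AddSubgroup.isAddQuotientCoveringMap_of_comm Λ.toAddSubgroup
    (isDiscrete_iff_discreteTopology.2 ‹_›)).isCoveringMap

theorem t2Space_torus {m : ℕ} (Λ : Submodule ℤ (Cn m)) [DiscreteTopology Λ] :
    T2Space (Cn m ⧸ Λ) := by
  have h : IsClosed (Λ.toAddSubgroup : Set (Cn m)) :=
    have : DiscreteTopology Λ.toAddSubgroup := ‹DiscreteTopology Λ›
    AddSubgroup.isClosed_of_discrete
  have : IsClosed (Λ.toAddSubgroup : Set (Cn m)) := h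
  exact inferInstanceAs (T2Space (Cn m ⧸ Λ.toAddSubgroup))

theorem compactSpace_torus {m : ℕ} (Λ : Submodule ℤ (Cn m)) [DiscreteTopology Λ]
    [IsZLattice ℝ Λ] : CompactSpace (Cn m ⧸ Λ) := by
  have h := IsZLattice.isCompact_range_of_periodic Λ
    (Submodule.Quotient.mk : Cn m → Cn m ⧸ Λ) (isCoveringMap_mk Λ).continuous
    fun z w hw => by
      rw [Submodule.Quotient.eq]; simpa using hw
  rw [Set.range_eq_univ.2 (Submodule.Quotient.mk_surjective Λ)] at h
  exact ⟨h⟩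

section

variable {m : ℕ} {M : Type*} [TopologicalSpace M] [ChartedSpace (Cn m) M]

theorem eq_of_isLocalDiffeomorph_comp {p : Cn m → M}
    (hp : IsLocalDiffeomorph 𝓘(ℂ, Cn m) 𝓘(ℂ, Cn m) ω p) {g₁ g₂ : Cn m → Cn m}
    (h₁ : Continuous g₁) (h₂ : Continuous g₂) (h : ∀ z, p (g₁ z) = p (g₂ z)) {z₀ : Cn m}
    (h₀ : g₁ z₀ = g₂ z₀) : g₁ = g₂ :=
  (T2Space.isSeparatedMap p).eq_of_comp_eq hp.isLocalHomeomorph.isLocallyInjective h₁ h₂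
    (funext h) z₀ h₀

/-- A local homeomorphism from a compact Hausdorff space to a Hausdorff space is a covering, so `p`
lifts first through `f` and then through the quotient map, with prescribed value at `z`. -/
theorem exists_lift_of_isEtaleFromTorus [T2Space M] {Λ : Submodule ℤ (Cn m)} [DiscreteTopology Λ]
    [IsZLattice ℝ Λ] {f : Cn m ⧸ Λ → M} (hf : IsEtaleFromTorus Λ f) {z w : Cn m}
    (h : f (Submodule.Quotient.mk z) = f (Submodule.Quotient.mk w)) :
    ∃ γ : Cn m → Cn m, Continuous γ ∧
      (∀ x, f (Submodule.Quotient.mk (γ x)) = f (Submodule.Quotient.mk x)) ∧ γ z = w := by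
  have := t2Space_torus Λ
  have := compactSpace_torus Λ
  have hq := isCoveringMap_mk Λ
  have hlh : IsLocalHomeomorph f := by
    rw [isLocalHomeomorph_iff_isLocalHomeomorphOn_univ,
      ← (Submodule.Quotient.mk_surjective Λ).range_eq, ← Set.image_univ]
    exact IsLocalHomeomorphOn.of_comp_right
      (IsLocalDiffeomorph.isLocalHomeomorph hf).isLocalHomeomorphOn
      hq.isLocalHomeomorph.isLocalHomeomorphOn
  have hc : IsCoveringMap f := isLocalHomeomorph_iff_isCoveringMap.1 hlh
  obtain ⟨g, ⟨hg₀, hg⟩, -⟩ := hc.existsUnique_continuousMap_lifts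
    ⟨fun x : Cn m => f (Submodule.Quotient.mk x), hc.continuous.comp hq.continuous⟩ z
    (Submodule.Quotient.mk w) h.symm
  obtain ⟨γ, ⟨hγ₀, hγ⟩, -⟩ := hq.existsUnique_continuousMap_lifts g z w hg₀.symm
  refine ⟨γ, γ.continuous, fun x => ?_, hγ₀⟩
  have h1 := congrFun hγ x
  have h2 := congrFun hg x
  simp only [Function.comp_apply, ContinuousMap.coe_mk] at h1 h2
  rw [h1, h2]

/-- Near each point `γ` is a local inverse of `p` composed with `p`. -/
theorem contDiff_of_isLocalDiffeomorph_comp {p : Cn m → M}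
    (hp : IsLocalDiffeomorph 𝓘(ℂ, Cn m) 𝓘(ℂ, Cn m) ω p) {γ : Cn m → Cn m}
    (hγ : Continuous γ) (h : ∀ z, p (γ z) = p z) : ContDiff ℂ ω γ := by
  rw [contDiff_iff_contDiffAt]
  intro z
  rw [← contMDiffAt_iff_contDiffAt]
  have hz := hp (γ z)
  have h1 : ContMDiffAt 𝓘(ℂ, Cn m) 𝓘(ℂ, Cn m) ω (hz.localInverse ∘ p) z := by
    refine ContMDiffAt.comp z ?_ (hp.contMDiff z)
    rw [← h z]
    exact hz.localInverse_contMDiffAt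
  refine h1.congr_of_eventuallyEq ?_
  filter_upwards [hγ.continuousAt.eventually hz.localInverse_eventuallyEq_left] with y hy
  simpa [h y] using hy.symm

end

/-- Liouville's theorem for functions which are periodic with respect to a lattice. -/
theorem exists_eq_const_of_periodic {m : ℕ} (Λ : Submodule ℤ (Cn m)) [DiscreteTopology Λ]
    [IsZLattice ℝ Λ] {F : Type*} [NormedAddCommGroup F] [NormedSpace ℂ F] {g : Cn m → F}
    (hg : Differentiable ℂ g) (hΛ : ∀ z, ∀ w ∈ Λ, g (z + w) = g z) (z w : Cn m) : g z = g w :=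
  hg.apply_eq_apply_of_bounded
    (IsZLattice.isCompact_range_of_periodic Λ g hg.continuous hΛ).isBounded z w


/-- The group of affine deck transformations of a map defined on `ℂ^m`. -/
def deckGroup {m : ℕ} {M : Type*} (p : Cn m → M) : Subgroup (Cn m ≃ᵃ[ℂ] Cn m) where
  carrier := {σ | ∀ z, p (σ z) = p z}
  mul_mem' {σ τ} hσ hτ z := by rw [AffineEquiv.coe_mul, Function.comp_apply, hσ, hτ]
  one_mem' z := rfl
  inv_mem' {σ} hσ z := by
    have := hσ (σ⁻¹ z)
    rw [← this]
    exact congrArg p (AffineEquiv.apply_symm_apply σ z)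

theorem mem_translations {m : ℕ} {Λ : Submodule ℤ (Cn m)} {σ : Cn m ≃ᵃ[ℂ] Cn m} :
    σ ∈ translations Λ ↔ ∃ v ∈ Λ, ∀ z, σ z = v + z := by
  constructor
  · rintro ⟨v, hv, rfl⟩
    exact ⟨v.toAdd, hv, fun z => rfl⟩
  · rintro ⟨v, hv, h⟩
    exact ⟨Multiplicative.ofAdd v, hv, by ext z : 1; exact (h z).symm⟩

theorem translations_le_deckGroup {m : ℕ} {M : Type*} {Λ : Submodule ℤ (Cn m)}
    (f : Cn m ⧸ Λ → M) :
    translations Λ ≤ deckGroup fun z => f (Submodule.Quotient.mk z) := by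
  intro σ hσ z
  obtain ⟨v, hv, h⟩ := mem_translations.1 hσ
  simp only [h]
  congr 1
  rw [Submodule.Quotient.eq]
  simpa using hv

section

variable {m : ℕ} {M : Type*} [TopologicalSpace M] [ChartedSpace (Cn m) M]

theorem continuous_affineEquiv (σ : Cn m ≃ᵃ[ℂ] Cn m) : Continuous σ :=
  AffineMap.continuous_of_finiteDimensional σ.toAffineMap

theorem eq_one_of_mem_deckGroup {p : Cn m → M}
    (hp : IsLocalDiffeomorph 𝓘(ℂ, Cn m) 𝓘(ℂ, Cn m) ω p) {σ : Cn m ≃ᵃ[ℂ] Cn m}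
    (hσ : σ ∈ deckGroup p) {z : Cn m} (hz : σ z = z) : σ = 1 :=
  DFunLike.coe_injective <|
    eq_of_isLocalDiffeomorph_comp (g₂ := id) hp (continuous_affineEquiv σ) continuous_id hσ hz

/-- Pigeonhole in a fibre with `K` points: two of `γ (n • w)`, `n ≤ K`, agree modulo `Λ`. By
uniqueness of lifts the corresponding translates of `γ` then differ by a constant, so the derivative
has a period `d • w` with `0 < d ≤ K`. Since `d` depends on `w`, the uniform multiple is `K!`. -/
theorem exists_fderiv_add_smul_eq {Λ : Submodule ℤ (Cn m)} {f : Cn m ⧸ Λ → M}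
    (hf : IsEtaleFromTorus Λ f) (hfin : ∀ y, (f ⁻¹' {y}).Finite) {γ : Cn m → Cn m}
    (hγ : Continuous γ)
    (h : ∀ x, f (Submodule.Quotient.mk (γ x)) = f (Submodule.Quotient.mk x)) :
    ∃ N : ℕ, N ≠ 0 ∧ ∀ z, ∀ w ∈ Λ, fderiv ℂ γ (z + N • w) = fderiv ℂ γ z := by
  set y := f (Submodule.Quotient.mk 0)
  set K := (hfin y).toFinset.card
  refine ⟨K.factorial, K.factorial_ne_zero, fun z w hw => ?_⟩
  have hper (n : ℕ) (x : Cn m) :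
      f (Submodule.Quotient.mk (x + n • w)) = f (Submodule.Quotient.mk x) := by
    congr 1
    rw [Submodule.Quotient.eq]
    simpa using Λ.smul_of_tower_mem n hw
  obtain ⟨n, hn, n', hn', hne, heq⟩ : ∃ n ∈ Finset.range (K + 1), ∃ n' ∈ Finset.range (K + 1),
      n ≠ n' ∧ (Submodule.Quotient.mk (γ (n • w)) : Cn m ⧸ Λ) =
        Submodule.Quotient.mk (γ (n' • w)) := by
    refine Finset.exists_ne_map_eq_of_card_lt_of_maps_to (t := (hfin y).toFinset) (by simp [K]) ?_
    intro n _
    have := hper n 0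
    rw [zero_add] at this
    simp only [Set.Finite.coe_toFinset]
    exact (h _).trans this
  wlog hlt : n < n' generalizing n n'
  · exact this n' hn' n hn hne.symm heq.symm (by omega)
  obtain ⟨d, rfl⟩ := Nat.exists_eq_add_of_lt hlt
  rw [Submodule.Quotient.eq] at heq
  set c := γ (n • w) - γ ((n + d + 1) • w)
  have hshift : (fun x => γ (x + n • w)) = fun x => γ (x + (n + d + 1) • w) + c := by
    refine eq_of_isLocalDiffeomorph_comp hf (by fun_prop) (by fun_prop) (fun x => ?_) (z₀ := 0) ?_
    · have : (Submodule.Quotient.mk (γ (x + (n + d + 1) • w) + c) : Cn m ⧸ Λ) =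
          Submodule.Quotient.mk (γ (x + (n + d + 1) • w)) := by
        rw [Submodule.Quotient.eq]; simpa using heq
      rw [this, h, h, hper, hper]
    · simp [c]
  have hstep (x : Cn m) : fderiv ℂ γ (x + (d + 1) • w) = fderiv ℂ γ x := by
    have h1 := congrArg (fun g => fderiv ℂ g (x - n • w)) hshift
    simp only [fderiv_add_const, fderiv_comp_add_right] at h1
    rw [sub_add_cancel] at h1
    rw [h1]
    congr 1
    rw [add_assoc n, add_smul n]
    abel
  obtain ⟨e, he⟩ : (d + 1) ∣ K.factorial := by
    refine Nat.dvd_factorial (by omega) ?_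
    have := Finset.mem_range.1 hn'
    omega
  rw [he]
  clear he
  induction e with
  | zero => simp
  | succ e ih => rw [Nat.mul_succ, add_smul, ← add_assoc, hstep, ih]

theorem exists_mem_deckGroup_coe_eq [T2Space M] {Λ : Submodule ℤ (Cn m)} [DiscreteTopology Λ]
    [IsZLattice ℝ Λ] {f : Cn m ⧸ Λ → M}
    (hf : IsEtaleFromTorus Λ f) (hfin : ∀ y, (f ⁻¹' {y}).Finite) {γ : Cn m → Cn m}
    (hγ : Continuous γ)
    (h : ∀ x, f (Submodule.Quotient.mk (γ x)) = f (Submodule.Quotient.mk x)) :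
    ∃ σ ∈ deckGroup (fun z => f (Submodule.Quotient.mk z)), ⇑σ = γ := by
  have hsm : ContDiff ℂ ω γ := contDiff_of_isLocalDiffeomorph_comp hf hγ h
  have hdiff : Differentiable ℂ γ := hsm.differentiable (by simp)
  obtain ⟨N, hN, hper⟩ := exists_fderiv_add_smul_eq hf hfin hγ h
  have hconst (z : Cn m) : fderiv ℂ γ z = fderiv ℂ γ 0 := by
    have hd : Differentiable ℂ (fderiv ℂ γ) :=
      (hsm.fderiv_right (m := ω) (by simp)).differentiable (by simp)
    have hN' : (N : ℂ) ≠ 0 := by exact_mod_cast hN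
    -- Rescaling by `N` turns periodicity under `N Λ` into periodicity under `Λ`.
    have := exists_eq_const_of_periodic Λ (g := fun x => fderiv ℂ γ ((N : ℂ) • x))
      (by fun_prop) (fun x w hw => by
        have := hper ((N : ℂ) • x) w hw
        rwa [← Nat.cast_smul_eq_nsmul ℂ N w, ← smul_add] at this) ((N : ℂ)⁻¹ • z) 0
    simpa [smul_smul, hN'] using this
  set A := fderiv ℂ γ 0
  have haff (z : Cn m) : γ z = A z + γ 0 := by
    have := (convex_univ (𝕜 := ℝ) (E := Cn m)).is_const_of_fderivWithin_eq_zero (𝕜 := ℂ)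
      (f := fun z => γ z - A z) (by fun_prop) (fun x _ => by
        rw [fderivWithin_univ, fderiv_fun_sub (hdiff x) A.differentiableAt, hconst,
          ContinuousLinearMap.fderiv, sub_self]) (Set.mem_univ z) (Set.mem_univ 0)
    simp only [map_zero, sub_zero] at this
    rw [← this]; abel
  -- The inverse of `γ` is the lift taking `γ 0` back to `0`.
  obtain ⟨δ, hδ, hδp, hδ0⟩ := exists_lift_of_isEtaleFromTorus hf (h 0)
  have hleft : δ ∘ γ = id := eq_of_isLocalDiffeomorph_comp hf (hδ.comp hγ) continuous_id
    (fun x => by simp [hδp, h]) (z₀ := 0) (by simp [hδ0])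
  have hright : γ ∘ δ = id := eq_of_isLocalDiffeomorph_comp hf (hγ.comp hδ) continuous_id
    (fun x => by simp [hδp, h]) (z₀ := γ 0) (by simp [hδ0])
  let φ : Cn m →ᵃ[ℂ] Cn m := AffineMap.mk' γ A.toLinearMap 0 fun z => by simpa using haff z
  have hφ : Function.Bijective φ := Function.bijective_iff_has_inverse.2
    ⟨δ, congrFun hleft, congrFun hright⟩
  exact ⟨AffineEquiv.ofBijective hφ, h, rfl⟩

theorem isQuotientBy_deckGroup [T2Space M] {Λ : Submodule ℤ (Cn m)} [DiscreteTopology Λ]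
    [IsZLattice ℝ Λ] {f : Cn m ⧸ Λ → M}
    (hf : IsEtaleFromTorus Λ f) (hsurj : Function.Surjective f)
    (hfin : ∀ y, (f ⁻¹' {y}).Finite) :
    IsQuotientBy M (deckGroup fun z => f (Submodule.Quotient.mk z)) := by
  refine ⟨_, hf, hsurj.comp (Submodule.Quotient.mk_surjective Λ), fun z w => ⟨fun h => ?_, ?_⟩⟩
  · obtain ⟨γ, hγ, hγp, hγz⟩ := exists_lift_of_isEtaleFromTorus hf h
    obtain ⟨σ, hσ, rfl⟩ := exists_mem_deckGroup_coe_eq hf hfin hγ hγp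
    exact ⟨σ, hσ, hγz⟩
  · rintro ⟨γ, hγ, rfl⟩
    exact (hγ z).symm

theorem finiteIndex_translations {Λ : Submodule ℤ (Cn m)} {f : Cn m ⧸ Λ → M}
    (hf : IsEtaleFromTorus Λ f) (hfin : ∀ y, (f ⁻¹' {y}).Finite) :
    ((translations Λ).subgroupOf (deckGroup fun z => f (Submodule.Quotient.mk z))).FiniteIndex := by
  set Γ := deckGroup fun z => f (Submodule.Quotient.mk z)
  have : Finite (f ⁻¹' {f (Submodule.Quotient.mk 0)}) := (hfin _).to_subtype
  have : Finite (Γ ⧸ (translations Λ).subgroupOf Γ) := by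
    -- Cosets embed into a fibre through the image of `0`. The inverse of the representative is used
    -- because these are left cosets: elements with the same image modulo `Λ` differ by a
    -- translation on the left.
    refine Finite.of_injective (β := f ⁻¹' {f (Submodule.Quotient.mk 0)})
      (fun q => ⟨Submodule.Quotient.mk ((q.out⁻¹ : Γ).1 0), (q.out⁻¹ : Γ).2 0⟩) ?_
    intro q q' h
    replace h := congrArg Subtype.val h
    replace h := (Submodule.Quotient.eq Λ).1 h
    rw [← q.out_eq', ← q'.out_eq', QuotientGroup.eq, Subgroup.mem_subgroupOf, mem_translations]
    refine ⟨_, h, fun z => ?_⟩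
    have key : (q.out⁻¹ : Γ).1 =
        (AffineEquiv.constVAdd ℂ (Cn m) ((q.out⁻¹ : Γ).1 0 - (q'.out⁻¹ : Γ).1 0)) *
          (q'.out⁻¹ : Γ).1 := by
      refine DFunLike.coe_injective (eq_of_isLocalDiffeomorph_comp hf
        (continuous_affineEquiv _) (continuous_affineEquiv _) (fun x => ?_) (z₀ := 0) ?_)
      · refine ((q.out⁻¹ : Γ).2 x).trans ?_
        refine Eq.symm ?_
        refine Eq.trans ?_ ((q'.out⁻¹ : Γ).2 x)
        simp only [AffineEquiv.coe_mul, Function.comp_apply, AffineEquiv.constVAdd_apply,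
          vadd_eq_add]
        congr 1
        rw [Submodule.Quotient.eq]
        simpa using h
      · simp [AffineEquiv.coe_mul]
    have hmul : ((q.out⁻¹ * q'.out : Γ) : Cn m ≃ᵃ[ℂ] Cn m) =
        AffineEquiv.constVAdd ℂ (Cn m) ((q.out⁻¹ : Γ).1 0 - (q'.out⁻¹ : Γ).1 0) := by
      rw [Subgroup.coe_mul, key, mul_assoc, ← Subgroup.coe_mul, inv_mul_cancel]
      simp
    rw [hmul]
    simp
  exact Subgroup.finiteIndex_of_finite_quotient

end

/-! ### Conformal classes on `ℂ^m` invariant under deck transformations -/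

/-- `B` is a field of nondegenerate symmetric bilinear forms on `ℂ^m` whose conformal class is
holomorphic and invariant under the deck transformations of `p`. -/
structure IsInvariantConformalClass {m : ℕ} {M : Type*} (p : Cn m → M)
    (B : Cn m → LinearMap.BilinForm ℂ (Cn m)) : Prop where
  symm (z u v : Cn m) : B z u v = B z v u
  nondegenerate (z u : Cn m) : (∀ v, B z u v = 0) → u = 0
  holomorphic (z₀ : Cn m) : ∃ B' : Cn m → Cn m → Cn m → ℂ,
    (∀ u v, DifferentiableAt ℂ (fun z => B' z u v) z₀) ∧
    ∀ᶠ z in nhds z₀, ∃ c : ℂ, c ≠ 0 ∧ ∀ u v, B z u v = c * B' z u v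
  invariant (γ : Cn m → Cn m) : Differentiable ℂ γ → (∀ z, p (γ z) = p z) →
    ∀ z, ∃ c : ℂ, c ≠ 0 ∧ ∀ u v, B (γ z) (fderiv ℂ γ z u) (fderiv ℂ γ z v) = c * B z u v

theorem transpose_mul_self_eq_one {n : ℕ} {A : Matrix (Fin n) (Fin n) ℂ}
    (h : ∀ u v, (A *ᵥ u) ⬝ᵥ (A *ᵥ v) = u ⬝ᵥ v) : Aᵀ * A = 1 := by
  refine Matrix.ext_of_mulVec_single fun i => ?_
  refine dotProduct_eq _ _ fun u => ?_
  rw [← Matrix.mulVec_mulVec, dotProduct_comm, Matrix.dotProduct_mulVec,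
    Matrix.vecMul_transpose, h, Matrix.one_mulVec, dotProduct_comm]

theorem det_ne_zero_of_nondegenerate {m : ℕ} {B : LinearMap.BilinForm ℂ (Cn m)}
    (hB : ∀ u, (∀ v, B u v = 0) → u = 0) :
    (Matrix.of fun i j => B (Pi.single i 1) (Pi.single j 1)).det ≠ 0 := by
  intro h
  obtain ⟨v, hv, hv0⟩ := Matrix.exists_vecMul_eq_zero_iff.2 h
  refine hv (hB v fun w => ?_)
  have h1 : B v = 0 := by
    refine (Pi.basisFun ℂ (Fin m)).ext fun j => ?_
    have h2 := congrFun hv0 j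
    simp only [Matrix.vecMul, dotProduct, Matrix.of_apply, Pi.zero_apply] at h2
    rw [Pi.basisFun_apply, LinearMap.zero_apply, ← h2]
    conv_lhs => rw [pi_eq_sum_univ' v]
    simp [LinearMap.sum_apply]
  rw [h1, LinearMap.zero_apply]

/-- `B` is holomorphic only up to an arbitrary pointwise scalar, so Liouville applies only to
quantities of degree zero in `B`. Dividing by the determinant, which never vanishes, yields entire
functions `g`; their constancy determines all ratios of coefficients. -/
theorem IsInvariantConformalClass.exists_eq_smul {m : ℕ} {M : Type*}
    {Λ : Submodule ℤ (Cn m)} [DiscreteTopology Λ] [IsZLattice ℝ Λ] {f : Cn m ⧸ Λ → M}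
    {B : Cn m → LinearMap.BilinForm ℂ (Cn m)}
    (hB : IsInvariantConformalClass (fun z => f (Submodule.Quotient.mk z)) B) (z : Cn m) :
    ∃ c : ℂ, c ≠ 0 ∧ B z = c • B 0 := by
  by_cases h0 : B 0 = 0
  · have : Subsingleton (Cn m) := ⟨fun u v => by
      rw [hB.nondegenerate 0 u (by simp [h0]), hB.nondegenerate 0 v (by simp [h0])]⟩
    exact ⟨1, one_ne_zero, by
      refine LinearMap.ext₂ fun u v => ?_
      rw [Subsingleton.elim u 0]
      simp⟩
  obtain ⟨i₀, j₀, hij⟩ : ∃ i₀ j₀, B 0 (Pi.single i₀ 1) (Pi.single j₀ 1) ≠ 0 := by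
    by_contra! h
    refine h0 ((Pi.basisFun ℂ (Fin m)).ext fun i => (Pi.basisFun ℂ (Fin m)).ext fun j => ?_)
    simpa using h i j
  set e : Fin m → Cn m := fun i => Pi.single i 1
  have hm : m - 1 + 1 = m := Nat.sub_add_cancel (by have := i₀.2; omega)
  let D (C : Cn m → Cn m → ℂ) : ℂ := (Matrix.of fun i j => C (e i) (e j)).det
  -- Numerator and determinant both have degree `m` in `C`.
  let g (C : Cn m → Cn m → ℂ) (i j : Fin m) : ℂ :=
    C (e i₀) (e j₀) ^ (m - 1) * C (e i) (e j) / D C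
  have hDsmul (c : ℂ) (C C' : Cn m → Cn m → ℂ) (h : ∀ u v, C u v = c * C' u v) :
      D C = c ^ m * D C' := by
    have : (Matrix.of fun i j => C (e i) (e j)) = c • Matrix.of fun i j => C' (e i) (e j) := by
      ext i j; simp [h]
    simp only [D]
    rw [this, Matrix.det_smul, Fintype.card_fin]
  have hgsmul (c : ℂ) (hc : c ≠ 0) (C C' : Cn m → Cn m → ℂ) (h : ∀ u v, C u v = c * C' u v)
      (i j : Fin m) : g C i j = g C' i j := by
    simp only [g]
    rw [hDsmul c C C' h, h, h, mul_pow, mul_mul_mul_comm, ← pow_succ, hm,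
      mul_div_mul_left _ _ (pow_ne_zero _ hc)]
  have hD (z : Cn m) : D (fun u v => B z u v) ≠ 0 :=
    det_ne_zero_of_nondegenerate (hB.nondegenerate z)
  have hgdiff (i j : Fin m) : Differentiable ℂ fun z => g (fun u v => B z u v) i j := by
    intro z₀
    obtain ⟨B', hB', hev⟩ := hB.holomorphic z₀
    have hne : D (B' z₀) ≠ 0 := by
      obtain ⟨c, hc, h⟩ := hev.self_of_nhds
      have := hD z₀
      rw [hDsmul c _ _ h] at this
      exact right_ne_zero_of_mul this
    have hdiff : DifferentiableAt ℂ (fun z => g (B' z) i j) z₀ := by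
      have hnum : DifferentiableAt ℂ
          (fun z => B' z (e i₀) (e j₀) ^ (m - 1) * B' z (e i) (e j)) z₀ :=
        ((hB' _ _).fun_pow _).fun_mul (hB' _ _)
      have hden : DifferentiableAt ℂ (fun z => D (B' z)) z₀ := by
        simp only [D, Matrix.det_apply, Matrix.of_apply]
        refine DifferentiableAt.fun_sum fun σ _ => DifferentiableAt.const_smul ?_ _
        exact (HasFDerivAt.finsetProd fun i _ => (hB' _ _).hasFDerivAt).differentiableAt
      simp only [g, div_eq_mul_inv]
      exact hnum.fun_mul (hden.fun_inv hne)
    refine hdiff.congr_of_eventuallyEq ?_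
    filter_upwards [hev] with z ⟨c, hc, h⟩
    exact hgsmul c hc _ _ h i j
  have hgconst (z : Cn m) (i j : Fin m) :
      g (fun u v => B z u v) i j = g (fun u v => B 0 u v) i j := by
    refine exists_eq_const_of_periodic Λ (hgdiff i j) (fun z w hw => ?_) z 0
    obtain ⟨c, hc, h⟩ := hB.invariant (fun x => x + w) (by fun_prop) (fun x => by
      congr 1
      rw [Submodule.Quotient.eq]
      simpa using hw) z
    simp only [fderiv_add_const, fderiv_fun_id, ContinuousLinearMap.id_apply] at h
    exact hgsmul c hc _ _ h i j
  have h00 := hgconst z i₀ j₀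
  simp only [g] at h00 hgconst
  have hne : B z (e i₀) (e j₀) ≠ 0 := by
    intro h
    rw [h, mul_zero, zero_div] at h00
    exact div_ne_zero (mul_ne_zero (pow_ne_zero _ hij) hij) (hD 0) h00.symm
  refine ⟨B z (e i₀) (e j₀) / B 0 (e i₀) (e j₀), div_ne_zero hne hij,
    (Pi.basisFun ℂ (Fin m)).ext fun i => (Pi.basisFun ℂ (Fin m)).ext fun j => ?_⟩
  have h1 := hgconst z i j
  have hD0 := hD 0
  have hDz := hD z
  simp only [Pi.basisFun_apply, LinearMap.smul_apply, smul_eq_mul]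
  change B z (e i) (e j) = _ * B 0 (e i) (e j)
  have hp := pow_ne_zero (m - 1) hne
  have hq := pow_ne_zero (m - 1) hij
  generalize D (fun u v => B z u v) = Dz at *
  generalize D (fun u v => B 0 u v) = D0 at *
  generalize B z (e i₀) (e j₀) ^ (m - 1) = P at *
  generalize B 0 (e i₀) (e j₀) ^ (m - 1) = Q at *
  change B 0 (e i₀) (e j₀) ≠ 0 at hij
  rw [div_eq_div_iff hDz hD0] at h00 h1
  rw [div_mul_eq_mul_div, eq_div_iff hij]
  -- Comparing the identity for `(i, j)` with that for `(i₀, j₀)` eliminates the powers and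
  -- determinants.
  refine mul_left_cancel₀ (mul_ne_zero (mul_ne_zero hp hq) (mul_ne_zero hD0 hDz)) ?_
  linear_combination (Q * Dz * B 0 (e i₀) (e j₀)) * h1 - (Q * Dz * B 0 (e i) (e j)) * h00

/-- Over `ℂ` a nondegenerate quadratic form is a sum of squares; polarisation recovers `B`. -/
theorem exists_linearEquiv_dotProduct {m : ℕ} {B : LinearMap.BilinForm ℂ (Cn m)}
    (hs : ∀ u v, B u v = B v u) (hB : ∀ u, (∀ v, B u v = 0) → u = 0) :
    ∃ P : Cn m ≃ₗ[ℂ] Cn m, ∀ u v, B (P u) (P v) = u ⬝ᵥ v := by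
  have hass : QuadraticMap.associated (R := ℂ) (LinearMap.BilinMap.toQuadraticMap B) = B :=
    QuadraticMap.associated_left_inverse ℂ hs
  have h := QuadraticForm.equivalent_weightedSumSquares_of_isAlgClosed
    (LinearMap.BilinMap.toQuadraticMap B) (by rw [hass]; exact hB)
  rw [Module.finrank_fin_fun] at h
  obtain ⟨⟨P, hP⟩⟩ := h
  refine ⟨P.symm, fun u v => ?_⟩
  have hq (x : Cn m) : B (P.symm x) (P.symm x) = x ⬝ᵥ x := by
    have := hP (P.symm x)
    simp only [QuadraticMap.weightedSumSquares_apply] at this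
    simpa [dotProduct] using this.symm
  have h1 := hq (u + v)
  simp only [map_add, LinearMap.add_apply, add_dotProduct, dotProduct_add, hq] at h1
  rw [hs (P.symm v), dotProduct_comm v u] at h1
  linear_combination h1 / 2

theorem isConformalAffine_of_dotProduct {m : ℕ} {σ : Cn m ≃ᵃ[ℂ] Cn m} {c : ℂ} (hc : c ≠ 0)
    (h : ∀ u v, (σ.linear u) ⬝ᵥ (σ.linear v) = c * (u ⬝ᵥ v)) : IsConformalAffine σ := by
  obtain ⟨s, hs⟩ := IsAlgClosed.exists_eq_mul_self c
  have hs0 : s ≠ 0 := by rintro rfl; simp [hs] at hc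
  refine ⟨s⁻¹ • LinearMap.toMatrix' σ.linear.toLinearMap, σ 0, s,
    transpose_mul_self_eq_one fun u v => ?_, hs0, fun z => ?_⟩
  · simp only [Matrix.smul_mulVec, LinearMap.toMatrix'_mulVec, LinearEquiv.coe_coe,
      smul_dotProduct, dotProduct_smul, h, smul_eq_mul]
    rw [hs]; field_simp
  · rw [Matrix.smul_mulVec, LinearMap.toMatrix'_mulVec, smul_smul, mul_inv_cancel₀ hs0, one_smul]
    have := σ.map_vadd 0 z
    simpa using this

/-- The coordinate change `P` makes `B 0` the dot product and replaces `Λ` by its preimage `Λ'`. For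
`σ` in the new deck group, `P σ P⁻¹` is an old deck transformation. Invariance (factor `c`) and
constancy of the class (factor `c'`) show that the linear part of `σ` scales the dot product by `c /
c'`. -/
theorem isComplexTorus_or_isConformallyHyperelliptic {m : ℕ} {M : Type*} [TopologicalSpace M]
    [T2Space M] [ChartedSpace (Cn m) M] {Λ : Submodule ℤ (Cn m)} [DiscreteTopology Λ]
    [IsZLattice ℝ Λ] {f : Cn m ⧸ Λ → M} (hf : IsEtaleFromTorus Λ f)
    (hsurj : Function.Surjective f) (hfin : ∀ y, (f ⁻¹' {y}).Finite)
    {B : Cn m → LinearMap.BilinForm ℂ (Cn m)}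
    (hB : IsInvariantConformalClass (fun z => f (Submodule.Quotient.mk z)) B) :
    IsComplexTorus m M ∨ IsConformallyHyperelliptic m M := by
  refine or_iff_not_imp_left.2 fun hnot => ⟨hnot, ?_⟩
  obtain ⟨P₀, hP₀⟩ := exists_linearEquiv_dotProduct (hB.symm 0) (hB.nondegenerate 0)
  let P : Cn m ≃L[ℂ] Cn m := P₀.toContinuousLinearEquiv
  have hP (u v : Cn m) : B 0 (P u) (P v) = u ⬝ᵥ v := hP₀ u v
  let PR : Cn m ≃L[ℝ] Cn m := P.restrictScalars ℝ
  let Λ' : Submodule ℤ (Cn m) := ZLattice.comap ℝ Λ PR.toLinearMap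
  have hdisc : DiscreteTopology Λ' :=
    inferInstanceAs (DiscreteTopology (ZLattice.comap ℝ Λ PR.toLinearMap))
  have hlat : IsZLattice ℝ Λ' :=
    inferInstanceAs (IsZLattice ℝ (ZLattice.comap ℝ Λ PR.toLinearMap))
  have hmem (v : Cn m) : v ∈ Λ' ↔ P v ∈ Λ := Iff.rfl
  let q : Cn m ⧸ Λ' → Cn m ⧸ Λ :=
    Submodule.mapQ Λ' Λ (PR.toLinearMap.restrictScalars ℤ) le_rfl
  have hqmk (z : Cn m) : q (Submodule.Quotient.mk z) = Submodule.Quotient.mk (P z) := rfl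
  have hqinj : Function.Injective q := by
    intro a b
    obtain ⟨a, rfl⟩ := Submodule.Quotient.mk_surjective Λ' a
    obtain ⟨b, rfl⟩ := Submodule.Quotient.mk_surjective Λ' b
    rw [hqmk, hqmk, Submodule.Quotient.eq, Submodule.Quotient.eq, hmem, map_sub]
    exact id
  have hqsurj : Function.Surjective q := by
    intro a
    obtain ⟨a, rfl⟩ := Submodule.Quotient.mk_surjective Λ a
    exact ⟨Submodule.Quotient.mk (P.symm a), by rw [hqmk, P.apply_symm_apply]⟩
  let Φ : Cn m ≃ₘ^ω⟮𝓘(ℂ, Cn m), 𝓘(ℂ, Cn m)⟯ Cn m :=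
    ⟨P.toEquiv, P.contDiff.contMDiff, P.symm.contDiff.contMDiff⟩
  have hf' : IsEtaleFromTorus Λ' (f ∘ q) := fun z =>
    IsLocalDiffeomorphAt.comp (P := M) 𝓘(ℂ, Cn m) (Φ.isLocalDiffeomorph z) (hf (P z))
  have hfin' (y : M) : ((f ∘ q) ⁻¹' {y}).Finite := by
    rw [Set.preimage_comp]
    exact (hfin y).preimage hqinj.injOn
  refine ⟨_, fun σ hσ => ?_, fun σ hσ z => eq_one_of_mem_deckGroup hf' hσ,
    ⟨Λ', ⟨hdisc, hlat⟩, translations_le_deckGroup _, finiteIndex_translations hf' hfin'⟩,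
    isQuotientBy_deckGroup hf' (hsurj.comp hqsurj) hfin'⟩
  have hσz (z : Cn m) : σ z = σ.linear z + σ 0 := by simpa using σ.map_vadd 0 z
  let S : Cn m →L[ℂ] Cn m := LinearMap.toContinuousLinearMap σ.linear.toLinearMap
  let T : Cn m →L[ℂ] Cn m := P.toContinuousLinearMap ∘L S ∘L P.symm.toContinuousLinearMap
  have hT (z : Cn m) : HasFDerivAt (fun z => P (σ (P.symm z))) T z := by
    have : (fun z => P (σ (P.symm z))) = fun z => T z + P (σ 0) := by
      funext z
      rw [hσz, map_add]
      rfl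
    rw [this]
    exact T.hasFDerivAt.add_const _
  obtain ⟨c, hc, hinv⟩ := hB.invariant (fun z => P (σ (P.symm z)))
    (fun z => (hT z).differentiableAt) (fun z => by
      have := hσ (P.symm z)
      simpa [hqmk] using this) 0
  rw [(hT 0).fderiv] at hinv
  obtain ⟨c', hc', hc''⟩ := hB.exists_eq_smul (P (σ (P.symm 0)))
  rw [hc''] at hinv
  refine isConformalAffine_of_dotProduct (div_ne_zero hc hc') fun u v => ?_
  have h := hinv (P u) (P v)
  rw [LinearMap.smul_apply, LinearMap.smul_apply, smul_eq_mul, hP] at h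
  have h2 : B 0 (T (P u)) (T (P v)) = σ.linear u ⬝ᵥ σ.linear v := by
    rw [← hP]
    simp [T, S]
  rw [h2] at h
  rw [div_mul_eq_mul_div, eq_div_iff hc', mul_comm, h]

/-! ### The conformal class of a quadric structure -/

theorem mulVec_dotProduct_mulVec {n : ℕ} {A : Matrix (Fin n) (Fin n) ℂ} (hA : Aᵀ * A = 1)
    (u v : Cn n) : (A *ᵥ u) ⬝ᵥ (A *ᵥ v) = u ⬝ᵥ v := by
  rw [← Matrix.vecMul_transpose A u, ← Matrix.dotProduct_mulVec, Matrix.mulVec_mulVec, hA,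
    Matrix.one_mulVec]

theorem projOrthogonal_mk {n : ℕ} {A : Matrix (Fin n) (Fin n) ℂ} (hA : Aᵀ * A = 1) {Z : Cn n}
    (hZ : Z ≠ 0) : ∃ h : A *ᵥ Z ≠ 0,
      projOrthogonal A hA (Projectivization.mk ℂ Z hZ) = Projectivization.mk ℂ (A *ᵥ Z) h := by
  refine ⟨fun h => hZ (dotProduct_eq_zero _ fun b => ?_), rfl⟩
  rw [← mulVec_dotProduct_mulVec hA, h, zero_dotProduct]

/-- The span of `w` and the image of `T` has dimension `m + 1`, so its orthogonal complement is a
line. That line contains `w` and `T u`, which forces `T u` into `ℂ w`. -/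
theorem eq_zero_of_forall_dotProduct_eq_zero {m : ℕ} {w : Cn (m + 2)} (hw : w ≠ 0)
    (hww : w ⬝ᵥ w = 0) {T : Cn m →ₗ[ℂ] Cn (m + 2)} (hTw : ∀ u, T u ⬝ᵥ w = 0)
    (hT : ∀ u (c : ℂ), T u = c • w → u = 0) {u : Cn m} (hu : ∀ v, T u ⬝ᵥ T v = 0) : u = 0 := by
  let β : LinearMap.BilinForm ℂ (Cn (m + 2)) := dotProductBilin ℂ ℂ
  have hβ (a b : Cn (m + 2)) : β a b = a ⬝ᵥ b := rfl
  have hrefl : β.IsRefl := fun a b h => by rw [hβ] at h ⊢; rwa [dotProduct_comm]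
  have hnd : β.Nondegenerate :=
    (LinearMap.IsRefl.nondegenerate_iff_separatingLeft hrefl).2
      fun a h => dotProduct_eq_zero a fun b => h b
  let S : Cn m × ℂ →ₗ[ℂ] Cn (m + 2) := T.coprod (LinearMap.toSpanSingleton ℂ _ w)
  have hS : Function.Injective S := by
    rw [← LinearMap.ker_eq_bot, LinearMap.ker_eq_bot']
    rintro ⟨v, c⟩ h
    have h' : T v + c • w = 0 := h
    have hv : v = 0 := hT v (-c) (by rw [neg_smul]; exact eq_neg_of_add_eq_zero_left h')
    subst hv
    simpa [hw] using h'
  have hdim : Module.finrank ℂ (β.orthogonal (LinearMap.range S)) = 1 := by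
    rw [LinearMap.BilinForm.finrank_orthogonal hnd, LinearMap.finrank_range_of_inj hS]
    simp
  have hmem (a : Cn (m + 2)) (h1 : ∀ v, T v ⬝ᵥ a = 0) (h2 : w ⬝ᵥ a = 0) :
      a ∈ β.orthogonal (LinearMap.range S) := by
    rintro _ ⟨⟨v, c⟩, rfl⟩
    change (T v + c • w) ⬝ᵥ a = 0
    rw [add_dotProduct, smul_dotProduct, h1, h2, smul_zero, add_zero]
  obtain ⟨c, hc⟩ := (finrank_eq_one_iff_of_nonzero'
    (⟨w, hmem w hTw hww⟩ : β.orthogonal (LinearMap.range S))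
    (fun h => hw (congrArg Subtype.val h))).1 hdim
    ⟨T u, hmem (T u) (fun v => by rw [dotProduct_comm, hu]) (by rw [dotProduct_comm, hTw])⟩
  exact hT u c (congrArg Subtype.val hc).symm

theorem fderiv_dotProduct_eq_zero {m n : ℕ} {V : Cn m → Cn n} {z : Cn m}
    (hV : DifferentiableAt ℂ V z) (h : ∀ᶠ y in nhds z, V y ⬝ᵥ V y = 0) (u : Cn m) :
    fderiv ℂ V z u ⬝ᵥ V z = 0 := by
  have hc (k : Fin n) : HasFDerivAt (fun y => V y k)
      ((ContinuousLinearMap.proj k).comp (fderiv ℂ V z)) z :=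
    (hasFDerivAt_pi'.1 hV.hasFDerivAt) k
  have h1 : HasFDerivAt (fun y => V y ⬝ᵥ V y) _ z :=
    HasFDerivAt.fun_sum fun k (_ : k ∈ Finset.univ) => (hc k).mul (hc k)
  have h2 : HasFDerivAt (fun y => V y ⬝ᵥ V y) (0 : Cn m →L[ℂ] ℂ) z :=
    (hasFDerivAt_const (0 : ℂ) z).congr_of_eventuallyEq h
  have h3 := congrArg (fun L : Cn m →L[ℂ] ℂ => L u) (h1.unique h2)
  simp only [_root_.sum_apply, _root_.add_apply,
    _root_.smul_apply, ContinuousLinearMap.comp_apply,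
    ContinuousLinearMap.proj_apply, smul_eq_mul, _root_.zero_apply] at h3
  have h4 : 2 * (fderiv ℂ V z u ⬝ᵥ V z) = 0 := by
    rw [← h3, dotProduct, Finset.mul_sum]
    exact Finset.sum_congr rfl fun k _ => by ring
  simpa using h4

/-- If `V₁ = a V₂`, then `dV₁ = a dV₂ + da V₂`; the terms with `da` drop out since `V₂ · V₂ = 0` and
`V₂ · dV₂ = 0`. Hence the factor is `a ^ 2`. -/
theorem exists_dotProduct_fderiv_eq {m n : ℕ} {V₁ V₂ : Cn m → Cn n} {z : Cn m}
    (h₁ : DifferentiableAt ℂ V₁ z) (h₂ : DifferentiableAt ℂ V₂ z) (h0 : V₂ z ≠ 0)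
    (hnull : ∀ᶠ y in nhds z, V₂ y ⬝ᵥ V₂ y = 0)
    (h : ∀ᶠ y in nhds z, ∃ a : ℂ, a ≠ 0 ∧ V₁ y = a • V₂ y) :
    ∃ c : ℂ, c ≠ 0 ∧ ∀ u v, fderiv ℂ V₁ z u ⬝ᵥ fderiv ℂ V₁ z v =
      c * (fderiv ℂ V₂ z u ⬝ᵥ fderiv ℂ V₂ z v) := by
  obtain ⟨k, hk⟩ := Function.ne_iff.1 h0
  have hk' : V₂ z k ≠ 0 := hk
  -- The scalars are given only pointwise; a quotient of coordinates shows that they vary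
  -- differentiably.
  let a (y : Cn m) : ℂ := V₁ y k * (V₂ y k)⁻¹
  have ha : DifferentiableAt ℂ a z :=
    (differentiableAt_pi.1 h₁ k).fun_mul ((differentiableAt_pi.1 h₂ k).fun_inv hk')
  have heq : V₁ =ᶠ[nhds z] fun y => a y • V₂ y := by
    have hcont : ∀ᶠ y in nhds z, V₂ y k ≠ 0 :=
      (differentiableAt_pi.1 h₂ k).continuousAt.eventually_ne hk'
    filter_upwards [h, hcont] with y ⟨b, hb, hy⟩ hyk
    have : a y = b := by simp [a, hy, hyk]
    rw [this, hy]
  have haz : a z ≠ 0 := by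
    obtain ⟨b, hb, hz⟩ := h.self_of_nhds
    simp [a, hz, hk', hb]
  have hder := (ha.hasFDerivAt.smul h₂.hasFDerivAt).congr_of_eventuallyEq heq
  refine ⟨a z * a z, mul_ne_zero haz haz, fun u v => ?_⟩
  have hn := hnull.self_of_nhds
  have hu := fderiv_dotProduct_eq_zero h₂ hnull u
  have hv := fderiv_dotProduct_eq_zero h₂ hnull v
  rw [hder.fderiv]
  simp only [_root_.add_apply, _root_.smul_apply,
    ContinuousLinearMap.smulRight_apply, add_dotProduct, dotProduct_add, smul_dotProduct,
    dotProduct_smul, hn, hu, dotProduct_comm (V₂ z), hv, smul_eq_mul]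
  ring

/-- The form at `z` uses a chart and a lift chosen at `p z`, so it need not be continuous in `z`,
but near `z₀` it is proportional to the form of the fixed lift at `p z₀`. Since the choice depends
only on `p z`, deck transformations preserve it exactly. -/
theorem exists_isInvariantConformalClass_of_hasQuadricStructure {m : ℕ} {M : Type*}
    [TopologicalSpace M] [ChartedSpace (Cn m) M] [IsManifold 𝓘(ℂ, Cn m) ω M] {p : Cn m → M}
    (hp : IsLocalDiffeomorph 𝓘(ℂ, Cn m) 𝓘(ℂ, Cn m) ω p) (hM : HasQuadricStructure m M) :
    ∃ B, IsInvariantConformalClass p B := by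
  obtain ⟨ι, U, φ, hcov, hchart, htrans⟩ := hM
  choose i hi using hcov
  choose Z hZ hZφ hZinj using fun x => (hchart (i x)).immersive x (hi x)
  have hpd (z : Cn m) : MDifferentiableAt 𝓘(ℂ, Cn m) 𝓘(ℂ, Cn m) p z :=
    hp.mdifferentiable (by simp) z
  let W (x : M) (z : Cn m) : Cn (m + 2) := Z x (p z)
  have hW (x : M) (z : Cn m) (hx : p z = x) : ContDiffAt ℂ ω (W x) z := by
    subst hx
    exact ((hZ (p z)).comp z (hp.contMDiff z)).contDiffAt
  have hWd (x : M) (z : Cn m) (hx : p z = x) : DifferentiableAt ℂ (W x) z :=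
    (hW x z hx).differentiableAt (by simp)
  have hpt (z : Cn m) : Filter.Tendsto p (nhds z) (nhds (p z)) := hp.contMDiff.continuous.tendsto z
  have hWφ (x : M) (z : Cn m) (hx : p z = x) : ∀ᶠ y in nhds z, p y ∈ U (i x) ∧
      ∃ hy : W x y ≠ 0, φ (i x) (p y) = Projectivization.mk ℂ (W x y) hy := by
    subst hx
    exact ((hpt z).eventually (((hchart _).isOpen.mem_nhds (hi (p z))))).and
      ((hpt z).eventually (hZφ (p z)))
  have hnull (x : M) (z : Cn m) (hx : p z = x) : ∀ᶠ y in nhds z, W x y ⬝ᵥ W x y = 0 := by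
    filter_upwards [hWφ x z hx] with y ⟨hyU, hy, hyφ⟩
    rw [← mk_mem_quadric_iff m _ hy, ← hyφ]
    exact (hchart _).mapsTo hyU
  have hinj (z u : Cn m) (c : ℂ) (h : fderiv ℂ (W (p z)) z u = c • W (p z) z) : u = 0 := by
    have h1 : mfderiv 𝓘(ℂ, Cn m) 𝓘(ℂ, Cn (m + 2)) (W (p z)) z =
        (mfderiv 𝓘(ℂ, Cn m) 𝓘(ℂ, Cn (m + 2)) (Z (p z)) (p z)).comp
          (mfderiv 𝓘(ℂ, Cn m) 𝓘(ℂ, Cn m) p z) :=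
      mfderiv_comp z ((hZ (p z)).mdifferentiableAt (by simp)) (hpd z)
    rw [← mfderiv_eq_fderiv, h1] at h
    have h2 := hZinj (p z) (mfderiv 𝓘(ℂ, Cn m) 𝓘(ℂ, Cn m) p z u) c h
    rw [← hp.mfderivToContinuousLinearEquiv_coe (by simp)] at h2
    exact (ContinuousLinearEquiv.map_eq_zero_iff _).1 h2
  let β : LinearMap.BilinForm ℂ (Cn (m + 2)) := dotProductBilin ℂ ℂ
  refine ⟨fun z => β.comp (fderiv ℂ (W (p z)) z).toLinearMap (fderiv ℂ (W (p z)) z).toLinearMap,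
    ?_, ?_, ?_, ?_⟩
  · exact fun z u v => dotProduct_comm (fderiv ℂ (W (p z)) z u) (fderiv ℂ (W (p z)) z v)
  · intro z u hu
    obtain ⟨-, hne, -⟩ := (hWφ _ z rfl).self_of_nhds
    exact eq_zero_of_forall_dotProduct_eq_zero (T := (fderiv ℂ (W (p z)) z).toLinearMap) hne
      (hnull _ z rfl).self_of_nhds
      (fun u => fderiv_dotProduct_eq_zero (hWd _ z rfl) (hnull _ z rfl) u)
      (hinj z) hu
  · intro z₀
    refine ⟨fun z u v => fderiv ℂ (W (p z₀)) z u ⬝ᵥ fderiv ℂ (W (p z₀)) z v, fun u v => ?_, ?_⟩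
    · have h1 : DifferentiableAt ℂ (fderiv ℂ (W (p z₀))) z₀ :=
        ((hW _ z₀ rfl).fderiv_right (m := ω) (by simp)).differentiableAt (by simp)
      have h2 (u : Cn m) (k : Fin (m + 2)) :
          DifferentiableAt ℂ (fun z => fderiv ℂ (W (p z₀)) z u k) z₀ :=
        differentiableAt_pi.1 (h1.clm_apply (differentiableAt_const u)) k
      exact DifferentiableAt.fun_sum fun k _ => (h2 u k).fun_mul (h2 v k)
    · have hd : ∀ᶠ z in nhds z₀, DifferentiableAt ℂ (W (p z₀)) z := by
        filter_upwards [(hW _ z₀ rfl).eventually (by simp)] with z hz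
        exact hz.differentiableAt (by simp)
      filter_upwards [hd, (hnull _ z₀ rfl).eventually_nhds, (hWφ _ z₀ rfl).eventually_nhds]
        with z hzd hz0 hzφ
      obtain ⟨F, ⟨A, hA, rfl⟩, hF⟩ := htrans (i (p z)) (i (p z₀))
      let V (y : Cn m) : Cn (m + 2) := A.mulVecLin.toContinuousLinearMap (W (p z₀) y)
      have hVd : HasFDerivAt V (A.mulVecLin.toContinuousLinearMap ∘L fderiv ℂ (W (p z₀)) z) z :=
        A.mulVecLin.toContinuousLinearMap.hasFDerivAt.comp z hzd.hasFDerivAt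
      have hVne : V z ≠ 0 := by
        obtain ⟨-, hne, -⟩ := hzφ.self_of_nhds
        exact (projOrthogonal_mk hA hne).1
      obtain ⟨c, hc, h⟩ := exists_dotProduct_fderiv_eq (V₂ := V) (hWd _ z rfl)
        hVd.differentiableAt hVne
        (by filter_upwards [hz0] with y hy; exact (mulVec_dotProduct_mulVec hA _ _).trans hy)
        (by
          filter_upwards [hzφ, hWφ _ z rfl] with y ⟨hy1, hy2, hy3⟩ ⟨hy4, hy5, hy6⟩
          have := hF (p y) ⟨hy4, hy1⟩
          obtain ⟨hne, hmk⟩ := projOrthogonal_mk hA hy2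
          rw [hy3, hy6, hmk, Projectivization.mk_eq_mk_iff] at this
          obtain ⟨a, ha⟩ := this
          exact ⟨a, a.ne_zero, ha.symm⟩)
      refine ⟨c, hc, fun u v => (h u v).trans ?_⟩
      rw [hVd.fderiv]
      exact congrArg (c * ·) (mulVec_dotProduct_mulVec hA _ _)
  · intro γ hγ hpγ z
    refine ⟨1, one_ne_zero, fun u v => ?_⟩
    have hcomp : fderiv ℂ (W (p z)) z = (fderiv ℂ (W (p z)) (γ z)).comp (fderiv ℂ γ z) := by
      rw [← fderiv_comp z (hWd _ _ (hpγ z)) (hγ z)]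
      congr 1
      funext y
      simp [W, hpγ]
    simp only [hpγ z, LinearMap.BilinForm.comp_apply, one_mul]
    rw [hcomp]
    rfl

/-! ### The invariant conformal class of a holomorphic conformal structure -/

theorem contMDiff_mfderiv_apply {m : ℕ} {M : Type*} [TopologicalSpace M] [ChartedSpace (Cn m) M]
    [IsManifold 𝓘(ℂ, Cn m) ω M] {p : Cn m → M} (hp : ContMDiff 𝓘(ℂ, Cn m) 𝓘(ℂ, Cn m) ω p)
    (u : Cn m) :
    ContMDiff 𝓘(ℂ, Cn m) (𝓘(ℂ, Cn m).prod 𝓘(ℂ, Cn m)) ω fun z =>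
      Bundle.TotalSpace.mk' (Cn m) (E := fun x : M => TangentSpace 𝓘(ℂ, Cn m) x) (p z)
        (mfderiv 𝓘(ℂ, Cn m) 𝓘(ℂ, Cn m) p z u) := by
  have h1 : ContMDiff 𝓘(ℂ, Cn m) (𝓘(ℂ, Cn m).prod 𝓘(ℂ, Cn m)) ω fun z : Cn m =>
      (⟨z, u⟩ : TangentBundle 𝓘(ℂ, Cn m) (Cn m)) :=
    contMDiff_vectorSpace_iff_contDiff.2 contDiff_const
  exact (hp.contMDiff_tangentMap (m := ω) (by simp)).comp h1

/-- Pull `g` back by `p` and identify each fibre of `N` with `ℂ` separately. Near `z₀` one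
trivialization gives a holomorphic representative, and the two identifications of a line differ by a
nonzero scalar. -/
theorem exists_isInvariantConformalClass_of_hasHolomorphicConformalStructure {m : ℕ} {M : Type*}
    [TopologicalSpace M] [ChartedSpace (Cn m) M] [IsManifold 𝓘(ℂ, Cn m) ω M] {p : Cn m → M}
    (hp : IsLocalDiffeomorph 𝓘(ℂ, Cn m) 𝓘(ℂ, Cn m) ω p)
    (hM : HasHolomorphicConformalStructure m M) :
    ∃ B, IsInvariantConformalClass p B := by
  obtain ⟨N, ⟨g⟩⟩ := hM
  let L (x : M) : N.Fib x ≃L[ℂ] ℂ := VectorBundle.continuousLinearEquivAt ℂ ℂ N.Fib x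
  let dp (z : Cn m) : Cn m →L[ℂ] Cn m := mfderiv 𝓘(ℂ, Cn m) 𝓘(ℂ, Cn m) p z
  let G (x : M) : LinearMap.BilinForm ℂ (Cn m) := LinearMap.mk₂ ℂ
    (fun u v : Cn m => L x (g.form x u v))
    (fun u u' v => (congrArg (fun T => L x (T v)) ((g.form x).map_add u u')).trans
      ((L x).map_add _ _))
    (fun c u v => (congrArg (fun T => L x (T v)) ((g.form x).map_smul c u)).trans
      ((L x).map_smul _ _))
    (fun u v v' => (congrArg (L x) ((g.form x u).map_add v v')).trans ((L x).map_add _ _))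
    (fun c u v => (congrArg (L x) ((g.form x u).map_smul c v)).trans ((L x).map_smul _ _))
  have hG (x : M) (u v : Cn m) : G x u v = L x (g.form x u v) := rfl
  have hdp (z : Cn m) : Function.Bijective (dp z) := by
    have := (hp.mfderivToContinuousLinearEquiv (by simp) z).bijective
    rwa [← ContinuousLinearEquiv.coe_coe, hp.mfderivToContinuousLinearEquiv_coe] at this
  refine ⟨fun z => (G (p z)).comp (dp z).toLinearMap (dp z).toLinearMap, ?_, ?_, ?_, ?_⟩
  · intro z u v
    exact congrArg (L (p z)) (g.symm (p z) (dp z u) (dp z v))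
  · intro z u hu
    have h1 : dp z u = 0 := by
      refine g.nondegenerate (p z) (dp z u) fun w => ?_
      obtain ⟨v, rfl⟩ := (hdp z).2 w
      exact (L (p z)).map_eq_zero_iff.1 (hu v)
    exact (hdp z).1 (h1.trans (map_zero (dp z)).symm)
  · intro z₀
    let e := trivializationAt ℂ N.Fib (p z₀)
    refine ⟨fun z u v => (e ⟨p z, g.form (p z) (dp z u) (dp z v)⟩).2, fun u v => ?_, ?_⟩
    · have h1 := ContMDiffAt.clm_bundle_apply₂ (F₁ := Cn m) (F₂ := Cn m) (F₃ := ℂ)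
        (E₁ := fun x : M => TangentSpace 𝓘(ℂ, Cn m) x)
        (E₂ := fun x : M => TangentSpace 𝓘(ℂ, Cn m) x) (E₃ := N.Fib)
        (g.holomorphic.contMDiffAt.comp z₀ (hp.contMDiff z₀))
        (contMDiff_mfderiv_apply hp.contMDiff u z₀) (contMDiff_mfderiv_apply hp.contMDiff v z₀)
      rw [Bundle.contMDiffAt_totalSpace] at h1
      exact (h1.2.contDiffAt).differentiableAt (by simp)
    · have hmem : ∀ᶠ z in nhds z₀, p z ∈ e.baseSet :=
        hp.contMDiff.continuous.continuousAt.eventually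
          (e.open_baseSet.mem_nhds (FiberBundle.mem_baseSet_trivializationAt' (p z₀)))
      filter_upwards [hmem] with z hz
      let K := e.continuousLinearEquivAt ℂ (p z) hz
      refine ⟨L (p z) (K.symm 1), ?_, fun u v => ?_⟩
      · simp
      · change L (p z) _ = _ * K _
        rw [mul_comm, ← smul_eq_mul, ← map_smul, ← map_smul, smul_eq_mul, mul_one,
          K.symm_apply_apply]
        rfl
  · intro γ hγ hpγ z
    refine ⟨1, one_ne_zero, fun u v => ?_⟩
    have hcomp : dp z = (dp (γ z)).comp (fderiv ℂ γ z) := by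
      have h := mfderiv_comp z (hp.mdifferentiable (by simp) (γ z)) (hγ z).mdifferentiableAt
      have h2 : p ∘ γ = p := funext hpγ
      rw [h2, mfderiv_eq_fderiv] at h
      exact h
    change G (p (γ z)) (dp (γ z) (fderiv ℂ γ z u)) (dp (γ z) (fderiv ℂ γ z v)) =
      1 * G (p z) (dp z u) (dp z v)
    rw [hpγ, hcomp, one_mul]
    rfl

/-! ### Covers of quotients of `ℂ^m` by domains of local sections -/

/-- An open cover of `M` by the domains of holomorphic local sections of `p`, any two of which
differ by an element of `Γ` on the whole intersection of their domains. -/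
structure SectionCover {m : ℕ} {M : Type*} [TopologicalSpace M] [ChartedSpace (Cn m) M]
    (p : Cn m → M) (Γ : Subgroup (Cn m ≃ᵃ[ℂ] Cn m)) where
  /-- the open set around a point -/
  dom : M → Set M
  /-- the section over the open set around a point -/
  sec : M → M → Cn m
  isOpen_dom (x : M) : IsOpen (dom x)
  mem_dom (x : M) : x ∈ dom x
  contMDiffOn_sec (x : M) : ContMDiffOn 𝓘(ℂ, Cn m) 𝓘(ℂ, Cn m) ω (sec x) (dom x)
  apply_sec (x : M) {y : M} (hy : y ∈ dom x) : p (sec x y) = y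
  exists_eq (x x' : M) : ∃ γ ∈ Γ, ∀ y ∈ dom x ∩ dom x', sec x y = γ (sec x' y)

theorem exists_eqOn_of_sections {m : ℕ} {M : Type*} [TopologicalSpace M]
    [ChartedSpace (Cn m) M] {p : Cn m → M} (hp : IsLocalDiffeomorph 𝓘(ℂ, Cn m) 𝓘(ℂ, Cn m) ω p)
    {Γ : Subgroup (Cn m ≃ᵃ[ℂ] Cn m)} (hΓ : ∀ z w, p z = p w ↔ ∃ γ ∈ Γ, γ z = w) {U : Set M}
    (hU : IsPreconnected U) {s t : M → Cn m} (hs : ContinuousOn s U) (ht : ContinuousOn t U)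
    (hps : ∀ y ∈ U, p (s y) = y) (hpt : ∀ y ∈ U, p (t y) = y) {y₀ : M} (hy₀ : y₀ ∈ U) :
    ∃ γ ∈ Γ, ∀ y ∈ U, s y = γ (t y) := by
  obtain ⟨γ, hγ, h⟩ := (hΓ (t y₀) (s y₀)).1 (by rw [hps _ hy₀, hpt _ hy₀])
  refine ⟨γ, hγ, (T2Space.isSeparatedMap p).eqOn_of_comp_eqOn
    hp.isLocalHomeomorph.isLocallyInjective hU hs
    ((continuous_affineEquiv γ).comp_continuousOn ht) (fun y hy => ?_) hy₀ h.symm⟩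
  simp only [Function.comp_apply]
  rw [hps _ hy, ← (hΓ (t y) (γ (t y))).2 ⟨γ, hγ, rfl⟩, hpt _ hy]

/-- Overlaps may be disconnected, so uniqueness of lifts on the overlap is not enough. With a
Lebesgue entourage, two domains sharing a point `y` both lie where one section `t (j y)` is defined.
Each domain is connected, so its section differs from `t (j y)` by one group element, and the two
elements combine. -/
theorem nonempty_sectionCover {m : ℕ} {M : Type*} [TopologicalSpace M] [T2Space M]
    [CompactSpace M] [ChartedSpace (Cn m) M] {p : Cn m → M}
    (hp : IsLocalDiffeomorph 𝓘(ℂ, Cn m) 𝓘(ℂ, Cn m) ω p) (hsurj : Function.Surjective p)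
    {Γ : Subgroup (Cn m ≃ᵃ[ℂ] Cn m)} (hΓ : ∀ z w, p z = p w ↔ ∃ γ ∈ Γ, γ z = w) :
    Nonempty (SectionCover p Γ) := by
  have : LocallyConnectedSpace M := ChartedSpace.locallyConnectedSpace (Cn m) M
  choose z hz using hsurj
  let t (x : M) : M → Cn m := (hp (z x)).localInverse
  let W (x : M) : Set M := (hp (z x)).localInverse.source
  have hW (x : M) : IsOpen (W x) := (hp (z x)).localInverse_open_source
  have hxW (x : M) : x ∈ W x := by
    have := (hp (z x)).localInverse_mem_source
    rwa [hz] at this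
  have ht (x : M) : ContMDiffOn 𝓘(ℂ, Cn m) 𝓘(ℂ, Cn m) ω (t x) (W x) :=
    (hp (z x)).localInverse_contMDiffOn
  have hpt (x y : M) (hy : y ∈ W x) : p (t x y) = y := (hp (z x)).localInverse_right_inv hy
  let : UniformSpace M := uniformSpaceOfCompactR1
  obtain ⟨V, hV, hVW⟩ := lebesgue_number_lemma (U := W) isCompact_univ hW
    fun x _ => Set.mem_iUnion.2 ⟨x, hxW x⟩
  obtain ⟨V', hV', hsymm, hVV⟩ := comp_symm_mem_uniformity_sets hV
  choose j hj using fun x => hVW x (Set.mem_univ x)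
  let U (x : M) : Set M := connectedComponentIn (interior (UniformSpace.ball x V')) x
  have hxU (x : M) : x ∈ U x :=
    mem_connectedComponentIn (mem_interior_iff_mem_nhds.2 (UniformSpace.ball_mem_nhds x hV'))
  have hUV' (x y : M) (hy : y ∈ U x) : (x, y) ∈ V' :=
    interior_subset (s := UniformSpace.ball x V') (connectedComponentIn_subset _ _ hy)
  have hUball (x y : M) (hy : y ∈ U x) : U x ⊆ UniformSpace.ball y V := fun y' hy' =>
    hVV ⟨x, hsymm.symm _ _ (hUV' x y hy), hUV' x y' hy'⟩
  have hUj (x : M) : U x ⊆ W (j x) := (hUball x x (hxU x)).trans (hj x)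
  have hUpre (x : M) : IsPreconnected (U x) := isPreconnected_connectedComponentIn
  refine ⟨⟨U, fun x => t (j x), fun x => isOpen_interior.connectedComponentIn, hxU,
    fun x => (ht (j x)).mono (hUj x), fun x y hy => hpt _ _ (hUj x hy), fun x x' => ?_⟩⟩
  by_cases hne : (U x ∩ U x').Nonempty
  · obtain ⟨y, hy, hy'⟩ := hne
    have key (x : M) (hy : y ∈ U x) : ∃ γ ∈ Γ, ∀ y' ∈ U x, t (j x) y' = γ (t (j y) y') := by
      have hsub : U x ⊆ W (j y) := (hUball x y hy).trans (hj y)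
      exact exists_eqOn_of_sections hp hΓ (hUpre x) ((ht _).continuousOn.mono (hUj x))
        ((ht _).continuousOn.mono hsub) (fun y' h => hpt _ _ (hUj x h))
        (fun y' h => hpt _ _ (hsub h)) hy
    obtain ⟨γ, hγ, h⟩ := key x hy
    obtain ⟨γ', hγ', h'⟩ := key x' hy'
    refine ⟨γ * γ'⁻¹, Γ.mul_mem hγ (Γ.inv_mem hγ'), fun y' hy' => ?_⟩
    rw [h y' hy'.1, h' y' hy'.2, AffineEquiv.coe_mul, Function.comp_apply]
    exact congrArg γ (γ'.symm_apply_apply _).symm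
  · exact ⟨1, Γ.one_mem, fun y hy => (hne ⟨y, hy⟩).elim⟩

/-! ### The standard embedding of `ℂ^m` into the quadric -/

/-- The homogeneous coordinates `[1 - z² : i (1 + z²) : 2 z]` of the standard embedding of `ℂ^m`
into the quadric. -/
noncomputable def quadricLift {m : ℕ} (z : Cn m) : Cn (m + 2) :=
  Matrix.vecCons (1 - z ⬝ᵥ z) (Matrix.vecCons (Complex.I * (1 + z ⬝ᵥ z)) ((2 : ℂ) • z))

theorem quadricLift_dotProduct_self {m : ℕ} (z : Cn m) :
    quadricLift z ⬝ᵥ quadricLift z = 0 := by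
  simp only [quadricLift, Matrix.cons_dotProduct_cons, smul_dotProduct, dotProduct_smul,
    smul_eq_mul]
  linear_combination (1 + z ⬝ᵥ z) ^ 2 * Complex.I_mul_I

/-- A linear functional which is constant on the image of `quadricLift`. -/
noncomputable def quadricFunctional (m : ℕ) : Cn (m + 2) →L[ℂ] ℂ :=
  ContinuousLinearMap.proj 0 - Complex.I • ContinuousLinearMap.proj 1

theorem quadricFunctional_quadricLift {m : ℕ} (z : Cn m) :
    quadricFunctional m (quadricLift z) = 2 := by
  have : quadricFunctional m (quadricLift z) =
      (1 - z ⬝ᵥ z) - Complex.I * (Complex.I * (1 + z ⬝ᵥ z)) := rfl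
  rw [this]
  linear_combination -(1 + z ⬝ᵥ z) * Complex.I_mul_I

/-- A linear left inverse of `quadricLift`. -/
noncomputable def quadricProj (m : ℕ) : Cn (m + 2) →L[ℂ] Cn m :=
  ContinuousLinearMap.pi fun i => (2⁻¹ : ℂ) • ContinuousLinearMap.proj i.succ.succ

theorem quadricProj_quadricLift {m : ℕ} (z : Cn m) : quadricProj m (quadricLift z) = z := by
  funext i
  have : quadricProj m (quadricLift z) i = 2⁻¹ * (2 * z i) := rfl
  rw [this]
  ring

theorem quadricLift_ne_zero {m : ℕ} (z : Cn m) : quadricLift z ≠ 0 := by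
  intro h
  have := quadricFunctional_quadricLift z
  rw [h, map_zero] at this
  exact two_ne_zero this.symm

theorem eq_of_smul_quadricLift_eq {m : ℕ} {z w : Cn m} {a : ℂ}
    (h : a • quadricLift z = quadricLift w) : z = w := by
  have h1 := congrArg (quadricFunctional m) h
  rw [map_smul, quadricFunctional_quadricLift, quadricFunctional_quadricLift, smul_eq_mul] at h1
  have ha : a = 1 := by linear_combination h1 / 2
  rw [ha, one_smul] at h
  rw [← quadricProj_quadricLift z, h, quadricProj_quadricLift]

theorem contDiff_quadricLift {m : ℕ} : ContDiff ℂ ω (quadricLift (m := m)) := by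
  have hq : ContDiff ℂ ω fun z : Cn m => z ⬝ᵥ z :=
    ContDiff.sum fun i _ => (contDiff_apply ℂ ℂ i).mul (contDiff_apply ℂ ℂ i)
  rw [contDiff_pi]
  refine Fin.cases ?_ (Fin.cases ?_ fun i => ?_)
  · exact contDiff_const.sub hq
  · exact contDiff_const.mul (contDiff_const.add hq)
  · exact contDiff_const.mul (contDiff_apply ℂ ℂ i)

/-- In the coordinates `U`, `V`, `T` the form is `4 U V + T · T`, and `quadricLift z` is `(1, -z ·
z, 2 z)`. As `σ z · σ z` is a combination of `z · z`, the coordinates of `z` and `1`, the map `σ`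
acts linearly on lifts; the factor `a = c⁻¹` makes this action orthogonal. -/
theorem exists_mulVec_quadricLift {m : ℕ} {σ : Cn m ≃ᵃ[ℂ] Cn m} (hσ : IsConformalAffine σ) :
    ∃ A : Matrix (Fin (m + 2)) (Fin (m + 2)) ℂ, Aᵀ * A = 1 ∧ ∃ a : ℂ, a ≠ 0 ∧
      ∀ z, A *ᵥ quadricLift z = a • quadricLift (σ z) := by
  obtain ⟨A, b, c, hA, hc, hσ⟩ := hσ
  let U (Z : Cn (m + 2)) : ℂ := (Z 0 - Complex.I * Z 1) / 2
  let V (Z : Cn (m + 2)) : ℂ := (Z 0 + Complex.I * Z 1) / 2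
  let T (Z : Cn (m + 2)) : Cn m := fun i => Z i.succ.succ
  let U' (Z : Cn (m + 2)) : ℂ := c⁻¹ * U Z
  let V' (Z : Cn (m + 2)) : ℂ :=
    c⁻¹ * (c ^ 2 * V Z - c * ((A *ᵥ T Z) ⬝ᵥ b) - (b ⬝ᵥ b) * U Z)
  let T' (Z : Cn (m + 2)) : Cn m := A *ᵥ T Z + (c⁻¹ * 2 * U Z) • b
  let f (Z : Cn (m + 2)) : Cn (m + 2) :=
    Matrix.vecCons (U' Z + V' Z) (Matrix.vecCons (Complex.I * (U' Z - V' Z)) (T' Z))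
  have hUa (Z W) : U (Z + W) = U Z + U W := by simp only [U, Pi.add_apply]; ring
  have hVa (Z W) : V (Z + W) = V Z + V W := by simp only [V, Pi.add_apply]; ring
  have hTa (Z W) : T (Z + W) = T Z + T W := rfl
  have hUs (k : ℂ) (Z) : U (k • Z) = k * U Z := by
    simp only [U, Pi.smul_apply, smul_eq_mul]; ring
  have hVs (k : ℂ) (Z) : V (k • Z) = k * V Z := by
    simp only [V, Pi.smul_apply, smul_eq_mul]; ring
  have hTs (k : ℂ) (Z) : T (k • Z) = k • T Z := rfl
  let L : Cn (m + 2) →ₗ[ℂ] Cn (m + 2) :=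
    { toFun := f
      map_add' := fun Z W => by
        simp only [f, U', V', T', hUa, hVa, hTa, Matrix.mulVec_add, add_dotProduct,
          Matrix.cons_add_cons]
        congr 1
        · ring
        congr 1
        · ring
        · funext i
          simp only [Pi.add_apply, Pi.smul_apply, smul_eq_mul]; ring
      map_smul' := fun k Z => by
        simp only [f, U', V', T', hUs, hVs, hTs, Matrix.mulVec_smul, smul_dotProduct,
          Matrix.smul_cons, RingHom.id_apply, smul_eq_mul]
        congr 1
        · ring
        congr 1
        · ring
        · funext i
          simp only [Pi.add_apply, Pi.smul_apply, smul_eq_mul]; ring }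
  have hdot (Z W : Cn (m + 2)) : Z ⬝ᵥ W = 2 * (U Z * V W + V Z * U W) + T Z ⬝ᵥ T W := by
    have : Z ⬝ᵥ W = Z 0 * W 0 + (Z 1 * W 1 + T Z ⬝ᵥ T W) := by
      simp only [dotProduct, Fin.sum_univ_succ]; rfl
    rw [this]
    simp only [U, V]
    linear_combination Z 1 * W 1 * Complex.I_mul_I
  refine ⟨LinearMap.toMatrix' L, transpose_mul_self_eq_one fun Z W => ?_, c⁻¹, inv_ne_zero hc,
    fun z => ?_⟩
  · rw [LinearMap.toMatrix'_mulVec, LinearMap.toMatrix'_mulVec, hdot Z W]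
    change f Z ⬝ᵥ f W = _
    have hTT := mulVec_dotProduct_mulVec hA (T Z) (T W)
    simp only [f, T', Matrix.cons_dotProduct_cons, add_dotProduct, dotProduct_add,
      smul_dotProduct, dotProduct_smul, hTT, smul_eq_mul, U', V']
    rw [dotProduct_comm b (A *ᵥ T W)]
    field_simp
    rw [Complex.I_sq]
    ring
  · rw [LinearMap.toMatrix'_mulVec]
    change f (quadricLift z) = _
    have hU : U (quadricLift z) = 1 := by
      have : U (quadricLift z) = quadricFunctional m (quadricLift z) / 2 := rfl
      rw [this, quadricFunctional_quadricLift]; norm_num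
    have hV : V (quadricLift z) = - (z ⬝ᵥ z) := by
      have : V (quadricLift z) =
        ((1 - z ⬝ᵥ z) + Complex.I * (Complex.I * (1 + z ⬝ᵥ z))) / 2 := rfl
      rw [this]
      linear_combination (1 + z ⬝ᵥ z) * Complex.I_mul_I / 2
    have hT : T (quadricLift z) = (2 : ℂ) • z := rfl
    have hq : σ z ⬝ᵥ σ z = c ^ 2 * (z ⬝ᵥ z) + 2 * c * ((A *ᵥ z) ⬝ᵥ b) + b ⬝ᵥ b := by
      rw [hσ]
      simp only [add_dotProduct, dotProduct_add, smul_dotProduct, dotProduct_smul, smul_eq_mul,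
        mulVec_dotProduct_mulVec hA, dotProduct_comm b]
      ring
    have hl : quadricLift (σ z) = Matrix.vecCons (1 - σ z ⬝ᵥ σ z)
      (Matrix.vecCons (Complex.I * (1 + σ z ⬝ᵥ σ z)) ((2 : ℂ) • σ z)) := rfl
    rw [hl, hq, hσ]
    simp only [f, U', V', T', hU, hV, hT, Matrix.smul_cons, Matrix.mulVec_smul, smul_dotProduct,
      smul_eq_mul]
    congr 1
    · ring
    congr 1
    · ring
    · funext i
      simp only [Pi.add_apply, Pi.smul_apply, smul_eq_mul]
      field_simp

theorem SectionCover.hasQuadricStructure {m : ℕ} {M : Type*} [TopologicalSpace M]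
    [ChartedSpace (Cn m) M] {p : Cn m → M} (hp : IsLocalDiffeomorph 𝓘(ℂ, Cn m) 𝓘(ℂ, Cn m) ω p)
    {Γ : Subgroup (Cn m ≃ᵃ[ℂ] Cn m)} (S : SectionCover p Γ)
    (hΓ : ∀ γ ∈ Γ, IsConformalAffine γ) : HasQuadricStructure m M := by
  refine ⟨M, S.dom, fun x y => Projectivization.mk ℂ (quadricLift (S.sec x y))
    (quadricLift_ne_zero _), fun x => ⟨x, S.mem_dom x⟩, fun i => ⟨S.isOpen_dom i, ?_, ?_, ?_⟩,
    fun i j => ?_⟩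
  · intro x _
    rw [mk_mem_quadric_iff]
    exact quadricLift_dotProduct_self _
  · intro x hx y hy h
    obtain ⟨a, ha⟩ := (Projectivization.mk_eq_mk_iff ℂ _ _ _ _).1 h
    rw [← S.apply_sec i hx, ← S.apply_sec i hy]
    exact congrArg p (eq_of_smul_quadricLift_eq ha).symm
  · intro x hx
    have hsm : ContMDiffAt 𝓘(ℂ, Cn m) 𝓘(ℂ, Cn m) ω (S.sec i) x :=
      (S.contMDiffOn_sec i).contMDiffAt ((S.isOpen_dom i).mem_nhds hx)
    have hZ : ContMDiffAt 𝓘(ℂ, Cn m) 𝓘(ℂ, Cn (m + 2)) ω (fun y => quadricLift (S.sec i y)) x :=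
      contDiff_quadricLift.contMDiff.contMDiffAt.comp x hsm
    refine ⟨fun y => quadricLift (S.sec i y), hZ,
      Filter.Eventually.of_forall fun y => ⟨quadricLift_ne_zero _, rfl⟩, fun v c hvc => ?_⟩
    have hd := (hZ.mdifferentiableAt (by simp)).hasMFDerivAt
    -- A functional constant on lifts kills `dZ v` but not `Z`, so `c = 0`. Then `quadricProj` shows
    -- that the section has zero derivative along `v`, and `p ∘ sec = id` gives `v = 0`.
    have h1 := (quadricFunctional m).hasMFDerivAt.comp x hd
    have h2 : HasMFDerivAt 𝓘(ℂ, Cn m) 𝓘(ℂ, ℂ) (fun _ : M => (2 : ℂ)) x 0 := hasMFDerivAt_const _ _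
    have h3 : (quadricFunctional m ∘ fun y => quadricLift (S.sec i y)) = fun _ : M => (2 : ℂ) :=
      funext fun y => quadricFunctional_quadricLift _
    rw [h3] at h1
    have h4 := congrArg (fun T => T v) (hasMFDerivAt_unique h1 h2)
    have h5 : quadricFunctional m (c • quadricLift (S.sec i x)) = 0 := by
      rw [← hvc]; exact h4
    rw [map_smul, quadricFunctional_quadricLift] at h5
    have hc : c = 0 := by simpa using h5
    rw [hc, zero_smul] at hvc
    have hsec : S.sec i = quadricProj m ∘ fun y => quadricLift (S.sec i y) :=
      funext fun y => (quadricProj_quadricLift _).symm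
    have h6 := (quadricProj m).hasMFDerivAt.comp x hd
    rw [← hsec] at h6
    have h7 := (hp.mdifferentiable (by simp) (S.sec i x)).hasMFDerivAt.comp x h6
    have h8 : HasMFDerivAt 𝓘(ℂ, Cn m) 𝓘(ℂ, Cn m) (p ∘ S.sec i) x
        (ContinuousLinearMap.id ℂ (TangentSpace 𝓘(ℂ, Cn m) x)) := by
      refine (hasMFDerivAt_id x).congr_of_eventuallyEq ?_
      filter_upwards [(S.isOpen_dom i).mem_nhds hx] with y hy
      exact S.apply_sec i hy
    have h9 := congrArg (fun T => T v) (hasMFDerivAt_unique h8 h7)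
    have h10 : v = mfderiv 𝓘(ℂ, Cn m) 𝓘(ℂ, Cn m) p (S.sec i x) (quadricProj m
      (mfderiv 𝓘(ℂ, Cn m) 𝓘(ℂ, Cn (m + 2)) (fun y => quadricLift (S.sec i y)) x v)) := h9
    rw [h10, hvc, map_zero]
    exact map_zero _
  · obtain ⟨γ, hγ, h⟩ := S.exists_eq i j
    obtain ⟨A, hA, a, ha, hAγ⟩ := exists_mulVec_quadricLift (hΓ γ hγ)
    refine ⟨_, ⟨A, hA, rfl⟩, fun x hx => ?_⟩
    obtain ⟨hne, hmk⟩ := projOrthogonal_mk hA (quadricLift_ne_zero (S.sec j x))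
    rw [hmk, Projectivization.mk_eq_mk_iff']
    exact ⟨a⁻¹, by rw [hAγ, smul_smul, inv_mul_cancel₀ ha, one_smul, h x hx]⟩

/-! ### The holomorphic conformal structure of a conformal quotient of `ℂ^m` -/

/-- The scalar by which the linear part of a conformal affine map multiplies the standard
bilinear form. -/
noncomputable def conformalFactor {m : ℕ} (σ : Cn m ≃ᵃ[ℂ] Cn m) : ℂ :=
  if h : 0 < m then
    σ.linear (Pi.single ⟨0, h⟩ 1) ⬝ᵥ σ.linear (Pi.single ⟨0, h⟩ 1)
  -- In dimension zero any scalar would do; `1` keeps the factor multiplicative and normalised at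
  -- the identity.
  else 1

theorem exists_linear_dotProduct_linear {m : ℕ} {σ : Cn m ≃ᵃ[ℂ] Cn m} (hσ : IsConformalAffine σ) :
    ∃ c : ℂ, ∀ u v, σ.linear u ⬝ᵥ σ.linear v = c * (u ⬝ᵥ v) := by
  obtain ⟨A, b, c, hA, -, hσ⟩ := hσ
  have hl (u : Cn m) : σ.linear u = c • A *ᵥ u := by
    have h := σ.map_vadd 0 u
    simp only [vadd_eq_add, add_zero, hσ, Matrix.mulVec_zero, smul_zero, zero_add] at h
    exact (add_right_cancel h).symm
  refine ⟨c * c, fun u v => ?_⟩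
  rw [hl, hl, smul_dotProduct, dotProduct_smul, mulVec_dotProduct_mulVec hA, smul_eq_mul,
    smul_eq_mul, mul_assoc]

theorem linear_dotProduct_linear {m : ℕ} {σ : Cn m ≃ᵃ[ℂ] Cn m} (hσ : IsConformalAffine σ)
    (u v : Cn m) : σ.linear u ⬝ᵥ σ.linear v = conformalFactor σ * (u ⬝ᵥ v) := by
  obtain ⟨c, h⟩ := exists_linear_dotProduct_linear hσ
  by_cases hm : 0 < m
  · rw [conformalFactor, dif_pos hm, h, h, single_dotProduct, Pi.single_eq_same, one_mul, mul_one]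
  · obtain rfl : m = 0 := by omega
    simp

theorem conformalFactor_mul {m : ℕ} {σ : Cn m ≃ᵃ[ℂ] Cn m} (hσ : IsConformalAffine σ)
    (τ : Cn m ≃ᵃ[ℂ] Cn m) : conformalFactor (σ * τ) = conformalFactor σ * conformalFactor τ := by
  by_cases hm : 0 < m
  · have h := linear_dotProduct_linear hσ (τ.linear (Pi.single ⟨0, hm⟩ 1))
      (τ.linear (Pi.single ⟨0, hm⟩ 1))
    simp only [conformalFactor, dif_pos hm] at h ⊢
    exact h
  · simp [conformalFactor, hm]

theorem conformalFactor_one {m : ℕ} : conformalFactor (1 : Cn m ≃ᵃ[ℂ] Cn m) = 1 := by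
  by_cases hm : 0 < m
  · have h : (1 : Cn m ≃ᵃ[ℂ] Cn m).linear = LinearEquiv.refl ℂ (Cn m) := rfl
    simp [conformalFactor, hm, h]
  · simp [conformalFactor, hm]

namespace SectionCover

variable {m : ℕ} {M : Type*} [TopologicalSpace M] [ChartedSpace (Cn m) M] {p : Cn m → M}
  {Γ : Subgroup (Cn m ≃ᵃ[ℂ] Cn m)} (S : SectionCover p Γ)

/-- The element of the group relating two of the local sections of a cover. -/
noncomputable def trans (x y : M) : Cn m ≃ᵃ[ℂ] Cn m := (S.exists_eq x y).choose

theorem trans_mem (x y : M) : S.trans x y ∈ Γ := (S.exists_eq x y).choose_spec.1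

theorem sec_eq_trans_sec {x y z : M} (hx : z ∈ S.dom x) (hy : z ∈ S.dom y) :
    S.sec x z = S.trans x y (S.sec y z) := (S.exists_eq x y).choose_spec.2 z ⟨hx, hy⟩

theorem eq_of_apply_eq (hfree : ∀ γ ∈ Γ, ∀ z, γ z = z → γ = 1) {γ δ : Cn m ≃ᵃ[ℂ] Cn m}
    (hγ : γ ∈ Γ) (hδ : δ ∈ Γ) {z : Cn m} (h : γ z = δ z) : γ = δ := by
  refine (inv_mul_eq_one.1 (hfree (δ⁻¹ * γ) (Γ.mul_mem (Γ.inv_mem hδ) hγ) z ?_)).symm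
  rw [AffineEquiv.coe_mul, Function.comp_apply, h]
  exact δ.symm_apply_apply z

/-- Both sides agree at `S.sec i x`, and a free action determines a group element by one value. -/
theorem trans_mul_trans (hfree : ∀ γ ∈ Γ, ∀ z, γ z = z → γ = 1) {i j k x : M}
    (hi : x ∈ S.dom i) (hj : x ∈ S.dom j) (hk : x ∈ S.dom k) :
    S.trans k j * S.trans j i = S.trans k i := by
  refine eq_of_apply_eq hfree (Γ.mul_mem (S.trans_mem _ _) (S.trans_mem _ _)) (S.trans_mem _ _)
    (z := S.sec i x) ?_
  rw [AffineEquiv.coe_mul, Function.comp_apply, ← S.sec_eq_trans_sec hj hi,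
    ← S.sec_eq_trans_sec hk hj, ← S.sec_eq_trans_sec hk hi]

theorem trans_self (hfree : ∀ γ ∈ Γ, ∀ z, γ z = z → γ = 1) {i x : M} (hi : x ∈ S.dom i) :
    S.trans i i = 1 :=
  hfree _ (S.trans_mem i i) (S.sec i x) (S.sec_eq_trans_sec hi hi).symm

/-- The line bundle of scalars of the conformal class of a conformal quotient of `ℂ^m`. -/
noncomputable def lineBundleCore (hfree : ∀ γ ∈ Γ, ∀ z, γ z = z → γ = 1)
    (hΓ : ∀ γ ∈ Γ, IsConformalAffine γ) : VectorBundleCore ℂ M ℂ M where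
  baseSet := S.dom
  isOpen_baseSet := S.isOpen_dom
  indexAt := id
  mem_baseSet_at := S.mem_dom
  coordChange i j _ := conformalFactor (S.trans j i) • ContinuousLinearMap.id ℂ ℂ
  coordChange_self i x hx v := by
    rw [S.trans_self hfree hx, conformalFactor_one, one_smul, ContinuousLinearMap.id_apply]
  continuousOn_coordChange _ _ := continuousOn_const
  coordChange_comp i j k x hx v := by
    rw [← S.trans_mul_trans hfree hx.1.1 hx.1.2 hx.2, conformalFactor_mul (hΓ _ (S.trans_mem k j))]
    simp [mul_assoc]

theorem isContMDiff_lineBundleCore (hfree : ∀ γ ∈ Γ, ∀ z, γ z = z → γ = 1)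
    (hΓ : ∀ γ ∈ Γ, IsConformalAffine γ) :
    (S.lineBundleCore hfree hΓ).IsContMDiff 𝓘(ℂ, Cn m) ω where
  contMDiffOn_coordChange _ _ := contMDiffOn_const

/-- The line bundle of scalars of the conformal class of a conformal quotient of `ℂ^m`, as a
holomorphic line bundle. -/
noncomputable def lineBundle (hfree : ∀ γ ∈ Γ, ∀ z, γ z = z → γ = 1)
    (hΓ : ∀ γ ∈ Γ, IsConformalAffine γ) : HolomorphicLineBundle m M :=
  have := S.isContMDiff_lineBundleCore hfree hΓ
  { Fib := (S.lineBundleCore hfree hΓ).Fiber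
    isTopologicalAddGroup := fun _ => inferInstanceAs (IsTopologicalAddGroup ℂ)
    continuousSMul := fun _ => inferInstanceAs (ContinuousSMul ℂ ℂ)
    holomorphic := VectorBundleCore.instContMDiffVectorBundle _ }

end SectionCover

/-- The standard bilinear form as a continuous bilinear map. -/
noncomputable def dotProductL (m : ℕ) : Cn m →L[ℂ] Cn m →L[ℂ] ℂ :=
  LinearMap.toContinuousBilinearMap (dotProductBilin ℂ ℂ)

theorem contDiff_bilinearComp_self {E F G : Type*} [NormedAddCommGroup E] [NormedSpace ℂ E]
    [FiniteDimensional ℂ E] [NormedAddCommGroup F] [NormedSpace ℂ F] [NormedAddCommGroup G]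
    [NormedSpace ℂ G] (β : F →L[ℂ] F →L[ℂ] G) :
    ContDiff ℂ ω fun T : E →L[ℂ] F => β.bilinearComp T T := by
  rw [contDiff_clm_apply_iff]
  intro v
  have h : ContDiff ℂ ω fun T : E →L[ℂ] F => (β (T v)).comp T :=
    (β.contDiff.comp (contDiff_id.clm_apply contDiff_const)).clm_comp contDiff_id
  exact h

/-- The form at `x` uses the section indexed by `x`. Changing sections multiplies it by the
conformal factor, which is the transition function of the bundle, so in the trivialization at `x₀`
it is the pullback by the single holomorphic section `S.sec x₀`. -/
theorem SectionCover.hasHolomorphicConformalStructure {m : ℕ} {M : Type*} [TopologicalSpace M]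
    [ChartedSpace (Cn m) M] [IsManifold 𝓘(ℂ, Cn m) ω M] {p : Cn m → M}
    (hp : IsLocalDiffeomorph 𝓘(ℂ, Cn m) 𝓘(ℂ, Cn m) ω p)
    {Γ : Subgroup (Cn m ≃ᵃ[ℂ] Cn m)} (S : SectionCover p Γ)
    (hfree : ∀ γ ∈ Γ, ∀ z, γ z = z → γ = 1) (hΓ : ∀ γ ∈ Γ, IsConformalAffine γ) :
    HasHolomorphicConformalStructure m M := by
  let ds (i x : M) : Cn m →L[ℂ] Cn m := mfderiv 𝓘(ℂ, Cn m) 𝓘(ℂ, Cn m) (S.sec i) x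
  have hsm (i x : M) (hx : x ∈ S.dom i) : ContMDiffAt 𝓘(ℂ, Cn m) 𝓘(ℂ, Cn m) ω (S.sec i) x :=
    (S.contMDiffOn_sec i).contMDiffAt ((S.isOpen_dom i).mem_nhds hx)
  have hds (i x : M) (hx : x ∈ S.dom i) :
      HasMFDerivAt 𝓘(ℂ, Cn m) 𝓘(ℂ, Cn m) (S.sec i) x (ds i x) :=
    ((hsm i x hx).mdifferentiableAt (by simp)).hasMFDerivAt
  have hbij (x : M) : Function.Bijective (ds x x) := by
    have hinj : Function.Injective (ds x x) := by
      have h1 := (hp.mdifferentiable (by simp) (S.sec x x)).hasMFDerivAt.comp x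
        (hds x x (S.mem_dom x))
      have h2 : HasMFDerivAt 𝓘(ℂ, Cn m) 𝓘(ℂ, Cn m) (p ∘ S.sec x) x
          (ContinuousLinearMap.id ℂ (TangentSpace 𝓘(ℂ, Cn m) x)) := by
        refine (hasMFDerivAt_id x).congr_of_eventuallyEq ?_
        filter_upwards [(S.isOpen_dom x).mem_nhds (S.mem_dom x)] with y hy
        exact S.apply_sec x hy
      have h3 := hasMFDerivAt_unique h1 h2
      refine Function.LeftInverse.injective
        (g := mfderiv 𝓘(ℂ, Cn m) 𝓘(ℂ, Cn m) p (S.sec x x)) fun v => ?_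
      exact congrArg (fun T => T v) h3
    exact ⟨hinj, LinearMap.injective_iff_surjective (f := (ds x x).toLinearMap).1 hinj⟩
  have htrans (i j x : M) (hi : x ∈ S.dom i) (hj : x ∈ S.dom j) (a b : Cn m) :
      ds i x a ⬝ᵥ ds i x b = conformalFactor (S.trans i j) * (ds j x a ⬝ᵥ ds j x b) := by
    let σ := S.trans i j
    let T : Cn m →L[ℂ] Cn m := LinearMap.toContinuousLinearMap σ.linear.toLinearMap
    have hσ : HasMFDerivAt 𝓘(ℂ, Cn m) 𝓘(ℂ, Cn m) σ (S.sec j x) T := by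
      refine HasFDerivAt.hasMFDerivAt ?_
      have : (σ : Cn m → Cn m) = fun z => T z + σ 0 := by
        funext z
        have h : σ z = σ.linear z + σ 0 := by simpa using σ.map_vadd 0 z
        exact h
      rw [this]
      exact T.hasFDerivAt.add_const _
    have h1 := hσ.comp x (hds j x hj)
    have h2 : S.sec i =ᶠ[nhds x] σ ∘ S.sec j := by
      filter_upwards [(S.isOpen_dom i).mem_nhds hi, (S.isOpen_dom j).mem_nhds hj] with y h h'
      exact S.sec_eq_trans_sec h h'
    have h3 : ds i x = T.comp (ds j x) :=
      hasMFDerivAt_unique (hds i x hi) (h1.congr_of_eventuallyEq h2)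
    rw [h3]
    exact linear_dotProduct_linear (hΓ _ (S.trans_mem i j)) _ _
  let N := S.lineBundle hfree hΓ
  let form (x : M) : TangentSpace 𝓘(ℂ, Cn m) x →L[ℂ] TangentSpace 𝓘(ℂ, Cn m) x →L[ℂ] N.Fib x :=
    (dotProductL m).bilinearComp (ds x x) (ds x x)
  have hform (x : M) (a b : Cn m) : form x a b = (ds x x a ⬝ᵥ ds x x b : ℂ) := rfl
  refine ⟨N, ⟨⟨form, fun x v w => dotProduct_comm (ds x x v) (ds x x w), fun x v hv => ?_,
    fun x₀ => ?_⟩⟩⟩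
  · have h1 : ds x x v = 0 := dotProduct_eq_zero _ fun w => by
      obtain ⟨w, rfl⟩ := (hbij x).2 w
      exact hv w
    exact (hbij x).1 (h1.trans (map_zero (ds x x)).symm)
  · rw [contMDiffAt_hom_bundle]
    refine ⟨contMDiffAt_id, ?_⟩
    let T (x : M) : Cn m →L[ℂ] Cn m :=
      inTangentCoordinates 𝓘(ℂ, Cn m) 𝓘(ℂ, Cn m) id (S.sec x₀) (ds x₀) x₀ x
    have hT : ContMDiffAt 𝓘(ℂ, Cn m) 𝓘(ℂ, Cn m →L[ℂ] Cn m) ω T x₀ :=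
      (hsm x₀ x₀ (S.mem_dom x₀)).mfderiv_const (m := ω) (by simp)
    refine ((contDiff_bilinearComp_self (dotProductL m)).contMDiff.contMDiffAt.comp x₀ hT).congr_of_eventuallyEq ?_
    filter_upwards [(S.isOpen_dom x₀).mem_nhds (S.mem_dom x₀),
      (trivializationAt (Cn m) (TangentSpace 𝓘(ℂ, Cn m)) x₀).open_baseSet.mem_nhds
        (FiberBundle.mem_baseSet_trivializationAt' x₀)] with x hx hxt
    ext1 a
    ext1 b
    have hTx (a : Cn m) : T x a =
        ds x₀ x ((trivializationAt (Cn m) (TangentSpace 𝓘(ℂ, Cn m)) x₀).symm x a) := by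
      change (trivializationAt (Cn m) (TangentSpace 𝓘(ℂ, Cn m)) (S.sec x₀ x₀)).continuousLinearMapAt
        ℂ (S.sec x₀ x) (ds x₀ x ((trivializationAt (Cn m)
          (TangentSpace 𝓘(ℂ, Cn m)) x₀).symmL ℂ x a)) = _
      rw [TangentBundle.continuousLinearMapAt_model_space, Bundle.Trivialization.symmL_apply _ hxt]
      rfl
    refine (inCoordinates_apply_eq₂ hxt hxt hx).trans ?_
    rw [Bundle.Trivialization.coe_linearMapAt_of_mem (trivializationAt ℂ N.Fib x₀) hx]
    change conformalFactor (S.trans x₀ x) * (ds x x _ ⬝ᵥ ds x x _) = T x a ⬝ᵥ T x b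
    rw [hTx, hTx]
    exact (htrans x₀ x x hx (S.mem_dom x) _ _).symm

/-! ### The equivalence of the three conditions -/

theorem exists_isQuotientBy_of_isComplexTorus_or {m : ℕ} {M : Type*} [TopologicalSpace M]
    [ChartedSpace (Cn m) M] (h : IsComplexTorus m M ∨ IsConformallyHyperelliptic m M) :
    ∃ Γ : Subgroup (Cn m ≃ᵃ[ℂ] Cn m), (∀ γ ∈ Γ, IsConformalAffine γ) ∧
      (∀ γ ∈ Γ, ∀ z, γ z = z → γ = 1) ∧ IsQuotientBy M Γ := by
  rcases h with ⟨Λ, f, -, hf, hinj, hsurj⟩ | ⟨-, Γ, hconf, hfree, -, hquot⟩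
  · refine ⟨translations Λ, fun γ hγ => ?_, fun γ hγ z hz => ?_, _, hf,
      hsurj.comp (Submodule.Quotient.mk_surjective Λ), fun z w => ?_⟩
    · obtain ⟨v, -, hv⟩ := mem_translations.1 hγ
      exact ⟨1, v, 1, by simp, one_ne_zero, fun z => by simp [hv, add_comm]⟩
    · obtain ⟨v, -, hv⟩ := mem_translations.1 hγ
      rw [hv, add_eq_right] at hz
      ext x : 1
      rw [hv, hz, zero_add]
      rfl
    · rw [hinj.eq_iff, eq_comm, Submodule.Quotient.eq]
      constructor
      · intro h
        exact ⟨AffineEquiv.constVAdd ℂ (Cn m) (w - z), mem_translations.2 ⟨_, h, fun _ => rfl⟩,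
          by simp⟩
      · rintro ⟨γ, hγ, rfl⟩
        obtain ⟨v, hvΛ, hv⟩ := mem_translations.1 hγ
        rwa [hv, add_sub_cancel_right]
  · exact ⟨Γ, hconf, hfree, hquot⟩

end QuadricStructures

theorem mainTheorem7 (m : ℕ) (M : Type*) [TopologicalSpace M] [T2Space M]
    [ChartedSpace (QuadricStructures.Cn m) M]
    [IsManifold 𝓘(ℂ, QuadricStructures.Cn m) ω M]
    [CompactSpace M] [ConnectedSpace M]
    (hM : QuadricStructures.IsHyperelliptic m M) :
    List.TFAE [
      QuadricStructures.HasQuadricStructure m M,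
      QuadricStructures.HasHolomorphicConformalStructure m M,
      QuadricStructures.IsComplexTorus m M ∨ QuadricStructures.IsConformallyHyperelliptic m M] := by
  obtain ⟨Λ, f, ⟨hΛ, hΛ'⟩, hf, hsurj, hfin⟩ := hM
  tfae_have 1 → 3 := fun h =>
    have ⟨_, hB⟩ := QuadricStructures.exists_isInvariantConformalClass_of_hasQuadricStructure hf h
    QuadricStructures.isComplexTorus_or_isConformallyHyperelliptic hf hsurj hfin hB
  tfae_have 2 → 3 := fun h =>
    have ⟨_, hB⟩ :=
      QuadricStructures.exists_isInvariantConformalClass_of_hasHolomorphicConformalStructure hf h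
    QuadricStructures.isComplexTorus_or_isConformallyHyperelliptic hf hsurj hfin hB
  tfae_have 3 → 1 := fun h =>
    have ⟨_, hconf, _, _, hp, hps, hΓ⟩ :=
      QuadricStructures.exists_isQuotientBy_of_isComplexTorus_or h
    have ⟨S⟩ := QuadricStructures.nonempty_sectionCover hp hps hΓ
    S.hasQuadricStructure hp hconf
  tfae_have 3 → 2 := fun h =>
    have ⟨_, hconf, hfree, _, hp, hps, hΓ⟩ :=
      QuadricStructures.exists_isQuotientBy_of_isComplexTorus_or h
    have ⟨S⟩ := QuadricStructures.nonempty_sectionCover hp hps hΓ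
    S.hasHolomorphicConformalStructure hp hfree hconf
  tfae_finish
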